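/- Let $k$ be a field, let $f\in(x,y)\subset k[[x,y]]$ be such that the ideal $(\partial_x f,\partial_y f)$ has finite codimension over $k$ in $k[[x,y]]$, put $A=k[[x,y]]/(f)$, and let $M$ be a finitely generated torsion-free $A$-module of generic rank $1$ (that is, $K\otimes_A M$ is free of rank $1$ over the total ring of fractions $K$ of $A$). Let $\mathrm{Art}_k$ be the category of local Artinian $k$-algebras with residue field $k$, and let $\mathrm{Def}^{\mathrm{top}}_{A,M}:\mathrm{Art}_k\to\mathrm{Sets}$ be the functor that sends $R$ to the set of isomorphism classes of topological deformations of the pair $(A,M)$ over $R$: such a deformation consists of a flat $R$-algebra $A_R$ with an isomorphism of $k$-algebras $k\otimes_R A_R\cong A$, and an $A_R$-module $M_R$, flat over $R$, with an isomorphism $k\otimes_R M_R\cong M$ compatible with the first one, where $A_R$ and $M_R$ are complete and separated for the adic topology defined by the inverse image in $A_R$ of the ideal $(x,y)A$; isomorphisms of deformations are compatible with the identifications with $A$ and $M$, and the functor acts on morphisms by base change. Then $\mathrm{Def}^{\mathrm{top}}_{A,M}$ is formally smooth over $k$: for every surjection $R'\to R$ in $\mathrm{Art}_k$, the map $\mathrm{Def}^{\mathrm{top}}_{A,M}(R')\to\mathrm{Def}^{\mathrm{top}}_{A,M}(R)$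 is surjective. -/

import Mathlib

universe u v

namespace FormalDef

open CategoryTheory TensorProduct

section Completeness

/-- A finite module over an adically complete Noetherian ring is precomplete. -/
theorem isPrecomplete_of_finite {A : Type*} [CommRing A] (I : Ideal A)
    [IsPrecomplete I A] (N : Type*) [AddCommGroup N] [Module A N] [Module.Finite A N] :
    IsPrecomplete I N := by
  rw [← AdicCompletion.of_surjective_iff]
  intro y
  obtain ⟨t, rfl⟩ := AdicCompletion.ofTensorProduct_surjective_of_finite I N y
  induction t with
  | zero => exact ⟨0, by simp⟩
  | add x y hx hy =>
    obtain ⟨a, ha⟩ := hx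
    obtain ⟨b, hb⟩ := hy
    exact ⟨a + b, by simp [ha, hb]⟩
  | tmul r n =>
    obtain ⟨s, rfl⟩ := AdicCompletion.of_surjective I A r
    refine ⟨s • n, ?_⟩
    rw [AdicCompletion.ofTensorProduct_tmul]
    ext i
    simp
    rfl

/-- Precompleteness of finite modules over Noetherian rings is stable under extensions. -/
theorem isPrecomplete_of_submodule {B : Type u} [CommRing B] [IsNoetherianRing B] (n : Ideal B)
    {N : Type u} [AddCommGroup N] [Module B N] [Module.Finite B N] (K : Submodule B N)
    (hK : IsPrecomplete n K) (hQ : IsPrecomplete n (N ⧸ K)) : IsPrecomplete n N := by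
  rw [← AdicCompletion.of_surjective_iff] at *
  intro y
  obtain ⟨q, hq⟩ := hQ (AdicCompletion.map n K.mkQ y)
  obtain ⟨x, rfl⟩ := K.mkQ_surjective q
  have h0 : AdicCompletion.map n K.mkQ (y - AdicCompletion.of n N x) = 0 := by
    rw [map_sub, ← hq, AdicCompletion.map_of, sub_self]
  have hex := AdicCompletion.map_exact (I := n) K.injective_subtype
    (LinearMap.exact_subtype_mkQ K) K.mkQ_surjective
  obtain ⟨z, hz⟩ := (hex _).1 h0
  obtain ⟨w, rfl⟩ := hK z
  refine ⟨x + w, ?_⟩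
  rw [map_add]
  rw [AdicCompletion.map_of] at hz
  change _ + AdicCompletion.of n N (K.subtype w) = y
  rw [hz]; abel

/-- A finite module killed by a power of `J` is precomplete if `B ⧸ J` is. -/
theorem isPrecomplete_of_pow_smul {B : Type u} [CommRing B] [IsNoetherianRing B] (n J : Ideal B)
    (hB : IsPrecomplete (n.map (Ideal.Quotient.mk J)) (B ⧸ J)) (i : ℕ)
    (N : Type u) [AddCommGroup N] [Module B N] [Module.Finite B N]
    (hN : J ^ i • (⊤ : Submodule B N) = ⊥) : IsPrecomplete n N := by
  induction i generalizing N with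
  | zero =>
    have : Subsingleton N := by
      rw [pow_zero, Ideal.one_eq_top, Submodule.top_smul] at hN
      exact (Submodule.subsingleton_iff B).1 (subsingleton_of_bot_eq_top hN.symm)
    infer_instance
  | succ i ih =>
    refine isPrecomplete_of_submodule n (J • ⊤ : Submodule B N) (ih _ ?_) ?_
    · apply Submodule.map_injective_of_injective (Submodule.injective_subtype (J • ⊤))
      rw [Submodule.map_smul'', Submodule.map_top, Submodule.range_subtype, Submodule.map_bot,
        ← Submodule.mul_smul, ← pow_succ, hN]
    · have : Module.Finite (B ⧸ J) (N ⧸ (J • ⊤ : Submodule B N)) :=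
        Module.Finite.of_restrictScalars_finite B _ _
      have h := isPrecomplete_of_finite (n.map (Ideal.Quotient.mk J)) (N ⧸ (J • ⊤ : Submodule B N))
      exact (IsPrecomplete.map_algebraMap_iff (R := B) (S := B ⧸ J)).1 h

variable {A B : Type u} [CommRing A] [CommRing B]

/-- A ring is Noetherian if it is so modulo a finitely generated nilpotent ideal. -/
theorem isNoetherianRing_of_nilpotent_ker [IsNoetherianRing A] (π : B →+* A)
    (hπ : Function.Surjective π) (hfg : (RingHom.ker π).FG) (hnil : IsNilpotent (RingHom.ker π)) :
    IsNoetherianRing B := by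
  refine IsNoetherianRing.of_prime fun P hP => ?_
  have hle : RingHom.ker π ≤ P := by
    intro x hx
    obtain ⟨n, hn⟩ := hnil
    refine hP.mem_of_pow_mem n ?_
    have : x ^ n ∈ RingHom.ker π ^ n := Ideal.pow_mem_pow hx n
    rw [hn] at this
    rw [show x ^ n = 0 from this]
    exact P.zero_mem
  obtain ⟨s, hs⟩ : (P.map π).FG := IsNoetherian.noetherian _
  have hlift : ∀ a : s, ∃ b ∈ P, π b = a := fun a =>
    (Ideal.mem_map_iff_of_surjective π hπ).1 (hs ▸ Ideal.subset_span a.2)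
  choose t ht hta using hlift
  have hP' : P = Ideal.span (Set.range t) ⊔ RingHom.ker π := by
    refine le_antisymm (fun p hp => ?_) (sup_le (Ideal.span_le.2 ?_) hle)
    · have h1 : π p ∈ (Ideal.span (Set.range t)).map π := by
        rw [Ideal.map_span, ← Set.range_comp]
        have : Set.range (π ∘ t) = s := by
          ext a; constructor
          · rintro ⟨b, rfl⟩; simp [hta]
          · intro h; exact ⟨⟨a, h⟩, hta _⟩
        rw [this]
        have h2 := Ideal.mem_map_of_mem π hp
        rw [← hs] at h2
        exact h2
      obtain ⟨q, hq, hqp⟩ := (Ideal.mem_map_iff_of_surjective π hπ).1 h1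
      exact Submodule.mem_sup.2 ⟨q, hq, p - q, by rw [RingHom.mem_ker, map_sub, hqp, sub_self],
        by abel⟩
    · rintro _ ⟨a, rfl⟩; exact ht a
  rw [hP']
  exact Submodule.FG.sup (Submodule.fg_span (Set.finite_range t)) hfg

/-- A module is finite if it is so modulo a nilpotent ideal. -/
theorem finite_of_nilpotent_ker (π : B →+* A) (hπ : Function.Surjective π)
    (hnil : IsNilpotent (RingHom.ker π)) {N M : Type u} [AddCommGroup N] [Module B N]
    [AddCommGroup M] [Module A M] [Module.Finite A M] (ρ : N →+ M)
    (hρ : ∀ b n, ρ (b • n) = π b • ρ n) (hsurj : Function.Surjective ρ)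
    (hker : ∀ n, ρ n = 0 → n ∈ (RingHom.ker π • ⊤ : Submodule B N)) : Module.Finite B N := by
  obtain ⟨r, e, he⟩ := Module.Finite.exists_fin (R := A) (M := M)
  choose x hx using fun i => hsurj (e i)
  have key : ∀ y : N, ∃ s ∈ Submodule.span B (Set.range x), y - s ∈ (RingHom.ker π • ⊤ : Submodule B N) := by
    intro y
    have : ρ y ∈ Submodule.span A (Set.range e) := by rw [he]; trivial
    obtain ⟨c, hc⟩ := (Submodule.mem_span_range_iff_exists_fun A).1 this
    choose d hd using fun i => hπ (c i)
    refine ⟨∑ i, d i • x i, Submodule.sum_mem _ fun i _ =>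
      Submodule.smul_mem _ _ (Submodule.subset_span ⟨i, rfl⟩), hker _ ?_⟩
    rw [map_sub, map_sum, ← hc]
    simp [hρ, hd, hx]
  have htop : Submodule.span B (Set.range x) = ⊤ := by
    have h : ∀ i : ℕ, (⊤ : Submodule B N) ≤
        Submodule.span B (Set.range x) ⊔ (RingHom.ker π) ^ i • ⊤ := by
      intro i
      induction i with
      | zero => simp
      | succ i ih =>
        have h1 : (⊤ : Submodule B N) ≤ Submodule.span B (Set.range x) ⊔ RingHom.ker π • ⊤ := by
          intro y _
          obtain ⟨s, hs, hy⟩ := key y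
          exact Submodule.mem_sup.2 ⟨s, hs, _, hy, by abel⟩
        calc (⊤ : Submodule B N) ≤ _ := ih
          _ ≤ Submodule.span B (Set.range x) ⊔ (RingHom.ker π) ^ i •
              (Submodule.span B (Set.range x) ⊔ RingHom.ker π • ⊤) :=
            sup_le_sup_left (smul_mono_right _ h1) _
          _ ≤ _ := by
            rw [Submodule.smul_sup, ← Submodule.mul_smul, ← pow_succ, ← sup_assoc]
            exact sup_le_sup_right (sup_le le_rfl Submodule.smul_le_right) _
    obtain ⟨n, hn⟩ := hnil
    have := h n
    rw [hn] at this
    simpa using this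
  exact ⟨⟨(Set.finite_range x).toFinset, by simpa using htop⟩⟩

/-- Completeness with respect to the adic topology can be tested modulo a finitely generated
nilpotent ideal. -/
theorem isAdicComplete_of_nilpotent_ker [IsNoetherianRing A] (I : Ideal A) [IsAdicComplete I A]
    (π : B →+* A) (hπ : Function.Surjective π)
    (hfg : (RingHom.ker π).FG) (hnil : IsNilpotent (RingHom.ker π))
    {N M : Type u} [AddCommGroup N] [Module B N]
    [AddCommGroup M] [Module A M] [Module.Finite A M] (ρ : N →+ M)
    (hρ : ∀ b n, ρ (b • n) = π b • ρ n) (hsurj : Function.Surjective ρ)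
    (hker : ∀ n, ρ n = 0 → n ∈ (RingHom.ker π • ⊤ : Submodule B N)) :
    IsAdicComplete (I.comap π) N := by
  have := isNoetherianRing_of_nilpotent_ker π hπ hfg hnil
  have := finite_of_nilpotent_ker π hπ hnil ρ hρ hsurj hker
  have h1 : IsHausdorff (I.comap π) N := by
    apply IsHausdorff.of_le_jacobson
    intro b hb
    rw [Ideal.mem_jacobson_bot]
    intro y
    have hu : IsUnit (π (b * y + 1)) := by
      have := Ideal.mem_jacobson_bot.1 (IsAdicComplete.le_jacobson_bot I hb) (π y)
      simpa using this
    obtain ⟨v, hv⟩ := hu.exists_right_inv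
    obtain ⟨w, rfl⟩ := hπ v
    have h2 : (b * y + 1) * w - 1 ∈ RingHom.ker π := by
      rw [RingHom.mem_ker, map_sub, map_mul, hv]; simp
    have h3 : IsNilpotent ((b * y + 1) * w - 1) := by
      obtain ⟨n, hn⟩ := hnil
      exact ⟨n, by simpa [hn] using Ideal.pow_mem_pow h2 n⟩
    have h4 := h3.isUnit_one_add
    rw [add_sub_cancel] at h4
    exact isUnit_of_mul_isUnit_left h4
  have h2 : IsPrecomplete (I.comap π) N := by
    obtain ⟨i, hi⟩ := hnil
    refine isPrecomplete_of_pow_smul _ (RingHom.ker π) ?_ i N (by rw [hi]; simp)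
    have hc : ((I.comap π).map (Ideal.Quotient.mk (RingHom.ker π))).map
        (RingHom.quotientKerEquivOfSurjective hπ) = I := by
      have h3 : (RingHom.quotientKerEquivOfSurjective hπ : B ⧸ RingHom.ker π →+* A).comp
        (Ideal.Quotient.mk (RingHom.ker π)) = π := by ext x; simp
      have h4 := Ideal.map_map (I := I.comap π) (Ideal.Quotient.mk (RingHom.ker π))
        (RingHom.quotientKerEquivOfSurjective hπ : B ⧸ RingHom.ker π →+* A)
      rw [h3, Ideal.map_comap_of_surjective π hπ] at h4
      exact h4
    rw [← IsPrecomplete.congr_ringEquiv _ (RingHom.quotientKerEquivOfSurjective hπ), hc]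
    infer_instance
  exact ⟨⟩

end Completeness

/-- An object of `Art_k`: a local Artinian `k`-algebra with residue field `k`. -/
structure ArtAlg (k : Type u) [Field k] : Type (u + 1) where
  carrier : Type u
  [commRing : CommRing carrier]
  [algebra : Algebra k carrier]
  [isLocalRing : IsLocalRing carrier]
  [isArtinianRing : IsArtinianRing carrier]
  residue_bijective : Function.Bijective (algebraMap k (IsLocalRing.ResidueField carrier))

namespace ArtAlg

variable {k : Type u} [Field k]

instance : CoeSort (ArtAlg k) (Type u) := ⟨carrier⟩

attribute [instance] commRing algebra isLocalRing isArtinianRing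

/-- The category `Art_k`; the morphisms are the homomorphisms of `k`-algebras
(they are automatically local). -/
instance : Category (ArtAlg k) where
  Hom R S := R →ₐ[k] S
  id R := AlgHom.id k R
  comp f g := g.comp f

/-- The homomorphism of `k`-algebras underlying a morphism of `Art_k`. -/
def toAlgHom {R S : ArtAlg k} (φ : R ⟶ S) : R →ₐ[k] S := φ

/-- The maximal ideal of an object of `Art_k`. -/
abbrev max (R : ArtAlg k) : Ideal R := IsLocalRing.maximalIdeal R

theorem isNilpotent_max (R : ArtAlg k) : IsNilpotent R.max :=
  (isArtinianRing_iff_isNilpotent_maximalIdeal R).1 inferInstance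

/-- Every element of `R` is the sum of a scalar and an element of the maximal ideal. -/
theorem exists_scalar (R : ArtAlg k) (r : R) : ∃ c : k, r - algebraMap k R c ∈ R.max := by
  obtain ⟨c, hc⟩ := R.residue_bijective.2 (IsLocalRing.residue R r)
  refine ⟨c, ?_⟩
  rw [← Ideal.Quotient.eq_zero_iff_mem]
  change IsLocalRing.residue R _ = 0
  rw [map_sub, ← hc, sub_eq_zero]
  rfl

theorem toAlgHom_mem_max {R S : ArtAlg k} (φ : R ⟶ S) {r : R} (hr : r ∈ R.max) :
    toAlgHom φ r ∈ S.max := by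
  obtain ⟨n, hn⟩ := R.isNilpotent_max
  have h : r ^ n = 0 := by
    have := Ideal.pow_mem_pow hr n
    rwa [hn] at this
  refine (IsLocalRing.mem_maximalIdeal _).2 fun hu => ?_
  have h1 := hu.pow n
  rw [← map_pow, h, map_zero] at h1
  exact not_isUnit_zero h1

/-- The reduction homomorphism `R → k`. -/
noncomputable def toBase (R : ArtAlg k) : R →ₐ[k] k :=
  (AlgEquiv.ofBijective (Algebra.ofId k (IsLocalRing.ResidueField R))
    R.residue_bijective).symm.toAlgHom.comp (IsScalarTower.toAlgHom k R _)

theorem ker_toBase (R : ArtAlg k) : RingHom.ker (R.toBase : R →+* k) = R.max := by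
  ext r
  rw [RingHom.mem_ker, ← Ideal.Quotient.eq_zero_iff_mem]
  change (AlgEquiv.ofBijective (Algebra.ofId k (IsLocalRing.ResidueField R))
    R.residue_bijective).symm (IsLocalRing.residue R r) = 0 ↔ IsLocalRing.residue R r = 0
  exact EmbeddingLike.map_eq_zero_iff

theorem toBase_toAlgHom {R S : ArtAlg k} (φ : R ⟶ S) (r : R) :
    S.toBase (toAlgHom φ r) = R.toBase r := by
  obtain ⟨c, hc⟩ := R.exists_scalar r
  have h1 : R.toBase (r - algebraMap k R c) = 0 := by
    rw [← R.ker_toBase] at hc; exact hc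
  have h2 : S.toBase (toAlgHom φ (r - algebraMap k R c)) = 0 := by
    have := toAlgHom_mem_max φ hc
    rw [← S.ker_toBase] at this; exact this
  simp only [map_sub, AlgHom.commutes, sub_eq_zero] at h1 h2
  rw [h1, h2]

/-- A functor `Art_k → Ens` is formally smooth over `k` if it maps every surjection to a
surjection. -/
def FormallySmooth (F : ArtAlg k ⥤ Type v) : Prop :=
  ∀ ⦃R S : ArtAlg k⦄ (φ : R ⟶ S), Function.Surjective (toAlgHom φ) →
    Function.Surjective (F.map φ)

end ArtAlg

section Deformations

variable {k : Type u} [Field k] {A : Type u} [CommRing A] [Algebra k A] (I : Ideal A)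
  (M : Type u) [AddCommGroup M] [Module A M]

/-- A topological deformation over `R` of the pair `(A, M)`, where `A` is a `k`-algebra with its
`I`-adic topology and `M` is an `A`-module:

* a flat `R`-algebra `alg` with an isomorphism of `k`-algebras `k ⊗_R alg ≃ A`, given as a
  surjection `red : alg → A` with kernel `m_R alg`; it is complete and separated for its adic
  topology, which is defined by the inverse image of `I`;
* an `alg`-module `mod`, flat over `R`, with an isomorphism `k ⊗_R mod ≃ M` over the first one,
  given as a surjection `redMod : mod → M` with kernel `m_R mod`; it is complete and separated
  for the same topology. -/
structure TopDef (R : ArtAlg k) : Type (u + 1) where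
  alg : Type u
  [commRing : CommRing alg]
  [algebra : Algebra R alg]
  [flat : Module.Flat R alg]
  red : alg →+* A
  red_algebraMap : ∀ c : k, red (algebraMap R alg (algebraMap k R c)) = algebraMap k A c
  red_surjective : Function.Surjective red
  ker_red : RingHom.ker red = R.max.map (algebraMap R alg)
  complete : IsAdicComplete (I.comap red) alg
  mod : Type u
  [addCommGroup : AddCommGroup mod]
  [moduleBase : Module R mod]
  [module : Module alg mod]
  [isScalarTower : IsScalarTower R alg mod]
  [flatMod : Module.Flat R mod]
  redMod : mod →+ M
  redMod_smul : ∀ (b : alg) (n : mod), redMod (b • n) = red b • redMod n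
  redMod_surjective : Function.Surjective redMod
  redMod_eq_zero_iff : ∀ n : mod, redMod n = 0 ↔ n ∈ (R.max • ⊤ : Submodule R mod)
  completeMod : IsAdicComplete (I.comap red) mod

namespace TopDef

attribute [instance] commRing algebra flat addCommGroup moduleBase module isScalarTower flatMod

variable {I M} {R S T : ArtAlg k}

/-- Isomorphism of deformations: an isomorphism of the algebras over `R` and a compatible
isomorphism of the modules, both inducing the identity on `A` and on `M`. -/
structure Iso (D E : TopDef I M R) where
  equiv : D.alg ≃ₐ[R] E.alg
  red_equiv : ∀ b, E.red (equiv b) = D.red b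
  equivMod : D.mod ≃+ E.mod
  equivMod_smul : ∀ (b : D.alg) (n : D.mod), equivMod (b • n) = equiv b • equivMod n
  redMod_equivMod : ∀ n, E.redMod (equivMod n) = D.redMod n

theorem red_algebraMap_eq (D : TopDef I M R) (r : R) :
    D.red (algebraMap R D.alg r) = algebraMap k A (R.toBase r) := by
  obtain ⟨c, hc⟩ := R.exists_scalar r
  have h1 : R.toBase (r - algebraMap k R c) = 0 := by
    rw [← R.ker_toBase] at hc; exact hc
  have h2 : D.red (algebraMap R D.alg (r - algebraMap k R c)) = 0 := by
    have := Ideal.mem_map_of_mem (algebraMap R D.alg) hc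
    rw [← D.ker_red] at this; exact this
  rw [map_sub, AlgHom.commutes, sub_eq_zero] at h1
  rw [map_sub, map_sub, sub_eq_zero, D.red_algebraMap] at h2
  rw [h2, h1]; rfl

/-- Being isomorphic is an equivalence relation. -/
instance isoSetoid (I : Ideal A) (M : Type u) [AddCommGroup M] [Module A M] (R : ArtAlg k) :
    Setoid (TopDef I M R) where
  r D E := Nonempty (Iso D E)
  iseqv :=
    { refl := fun D => ⟨⟨AlgEquiv.refl, fun _ => rfl, AddEquiv.refl _, fun _ _ => rfl,
        fun _ => rfl⟩⟩
      symm := fun {D E} ⟨e⟩ => ⟨⟨e.equiv.symm, fun b => by rw [← e.red_equiv]; simp,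
        e.equivMod.symm, fun b n => by
          apply e.equivMod.injective
          rw [e.equivMod_smul]; simp, fun n => by rw [← e.redMod_equivMod]; simp⟩⟩
      trans := fun {D E F} ⟨e⟩ ⟨f⟩ => ⟨⟨e.equiv.trans f.equiv,
        fun b => by simp [f.red_equiv, e.red_equiv], e.equivMod.trans f.equivMod,
        fun b n => by simp [e.equivMod_smul, f.equivMod_smul],
        fun n => by simp [f.redMod_equivMod, e.redMod_equivMod]⟩⟩ }

/-- A morphism of deformations over a morphism `φ : R ⟶ S` of `Art_k`. -/
structure HomOver (φ : R ⟶ S) (D : TopDef I M R) (E : TopDef I M S) where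
  toHom : D.alg →+* E.alg
  toHom_algebraMap : ∀ r : R, toHom (algebraMap R D.alg r) =
    algebraMap S E.alg (ArtAlg.toAlgHom φ r)
  red_toHom : ∀ b, E.red (toHom b) = D.red b
  toHomMod : D.mod →+ E.mod
  toHomMod_smul : ∀ (b : D.alg) (n : D.mod), toHomMod (b • n) = toHom b • toHomMod n
  redMod_toHomMod : ∀ n, E.redMod (toHomMod n) = D.redMod n

/-- Composition of morphisms of deformations. -/
def HomOver.comp {φ : R ⟶ S} {ψ : S ⟶ T} {D : TopDef I M R} {E : TopDef I M S}
    {F : TopDef I M T} (g : HomOver ψ E F) (f : HomOver φ D E) : HomOver (φ ≫ ψ) D F where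
  toHom := g.toHom.comp f.toHom
  toHom_algebraMap r := by
    simp only [RingHom.comp_apply, f.toHom_algebraMap, g.toHom_algebraMap]; rfl
  red_toHom b := by simp [g.red_toHom, f.red_toHom]
  toHomMod := g.toHomMod.comp f.toHomMod
  toHomMod_smul b n := by simp [f.toHomMod_smul, g.toHomMod_smul]
  redMod_toHomMod n := by simp [g.redMod_toHomMod, f.redMod_toHomMod]

/-- An isomorphism is a morphism over the identity. -/
def Iso.homOver {D E : TopDef I M R} (e : Iso D E) : HomOver (𝟙 R) D E where
  toHom := e.equiv
  toHom_algebraMap r := e.equiv.commutes r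
  red_toHom := e.red_equiv
  toHomMod := e.equivMod
  toHomMod_smul := e.equivMod_smul
  redMod_toHomMod := e.redMod_equivMod

/-- A linear map into a flat module that is an isomorphism modulo a nilpotent ideal is
bijective. -/
theorem bijective_of_nilpotent {B : Type*} [CommRing B] {J : Ideal B} (hJ : IsNilpotent J)
    {N N' : Type*} [AddCommGroup N] [AddCommGroup N'] [Module B N] [Module B N']
    [Module.Flat B N'] (u : N →ₗ[B] N')
    (hs : ∀ y, ∃ x, y - u x ∈ (J • ⊤ : Submodule B N'))
    (hi : ∀ x, u x ∈ (J • ⊤ : Submodule B N') → x ∈ (J • ⊤ : Submodule B N)) :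
    Function.Bijective u := by
  obtain ⟨m, hm⟩ := hJ
  have hsurj : Function.Surjective u := by
    have h : ∀ i : ℕ, (⊤ : Submodule B N') ≤ LinearMap.range u ⊔ J ^ i • ⊤ := by
      intro i
      induction i with
      | zero => simp
      | succ i ih =>
        have h1 : (⊤ : Submodule B N') ≤ LinearMap.range u ⊔ J • ⊤ := by
          intro y _
          obtain ⟨x, hx⟩ := hs y
          exact Submodule.mem_sup.2 ⟨u x, ⟨x, rfl⟩, _, hx, by abel⟩
        calc (⊤ : Submodule B N') ≤ _ := ih
          _ ≤ LinearMap.range u ⊔ J ^ i • (LinearMap.range u ⊔ J • ⊤) :=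
            sup_le_sup_left (smul_mono_right _ h1) _
          _ ≤ _ := by
            rw [Submodule.smul_sup, ← Submodule.mul_smul, ← pow_succ, ← sup_assoc]
            exact sup_le_sup_right (sup_le le_rfl Submodule.smul_le_right) _
    have := h m
    rw [hm] at this
    exact LinearMap.range_eq_top.1 (by simpa using this)
  refine ⟨?_, hsurj⟩
  have hK : LinearMap.ker u ≤ J • LinearMap.ker u := by
    intro x hx
    have hxJ : x ∈ (J • ⊤ : Submodule B N) := hi x (by rw [LinearMap.mem_ker.1 hx]; simp)
    have hinj := LinearMap.lTensor_injective_of_exact_of_flat u hsurj (LinearMap.ker u).subtype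
      (Submodule.subtype_injective _) (LinearMap.exact_subtype_ker_map u) (B ⧸ J)
    have h0 : (1 : B ⧸ J) ⊗ₜ[B] (⟨x, hx⟩ : LinearMap.ker u) = 0 := by
      apply hinj
      rw [map_zero, LinearMap.lTensor_tmul]
      change (1 : B ⧸ J) ⊗ₜ[B] x = 0
      refine Submodule.smul_induction_on hxJ ?_ ?_
      · intro r hr n _
        rw [← TensorProduct.smul_tmul]
        have : r • (1 : B ⧸ J) = 0 := by
          rw [Algebra.smul_def, mul_one]; exact Ideal.Quotient.eq_zero_iff_mem.2 hr
        rw [this, zero_tmul]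
      · intro a b ha hb
        rw [tmul_add, ha, hb, add_zero]
    have h1 := congrArg (TensorProduct.quotTensorEquivQuotSMul (LinearMap.ker u) J) h0
    rw [map_zero, ← map_one (Ideal.Quotient.mk J),
      TensorProduct.quotTensorEquivQuotSMul_mk_tmul, one_smul, Submodule.Quotient.mk_eq_zero] at h1
    have h2 := Submodule.mem_map_of_mem (f := (LinearMap.ker u).subtype) h1
    rwa [Submodule.map_smul'', Submodule.map_top, Submodule.range_subtype] at h2
  have h : ∀ i : ℕ, LinearMap.ker u ≤ J ^ i • LinearMap.ker u := by
    intro i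
    induction i with
    | zero => simp
    | succ i ih =>
      rw [pow_succ, Submodule.mul_smul]
      exact ih.trans (smul_mono_right _ hK)
  have := h m
  rw [hm] at this
  exact LinearMap.ker_eq_bot.1 (by simpa using this)

/-- A morphism of deformations over the identity is an isomorphism. -/
theorem HomOver.nonempty_iso {D E : TopDef I M R} (f : HomOver (𝟙 R) D E) :
    Nonempty (Iso D E) := by
  let u : D.alg →ₐ[R] E.alg := { f.toHom with commutes' := fun r => f.toHom_algebraMap r }
  have hu : ∀ b, u b = f.toHom b := fun _ => rfl
  let v : D.mod →ₗ[R] E.mod :=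
    { f.toHomMod with
      map_smul' := fun r n => by
        change f.toHomMod (r • n) = r • f.toHomMod n
        rw [← algebraMap_smul D.alg r n, f.toHomMod_smul, f.toHom_algebraMap]
        exact algebraMap_smul E.alg r _ }
  have hv : ∀ n, v n = f.toHomMod n := fun _ => rfl
  have hmem : ∀ (F : TopDef I M R) (b : F.alg), F.red b = 0 ↔ b ∈ (R.max • ⊤ : Submodule R F.alg) := by
    intro F b
    rw [Ideal.smul_top_eq_map, ← F.ker_red]; rfl
  have hub : Function.Bijective u := by
    refine bijective_of_nilpotent R.isNilpotent_max u.toLinearMap ?_ ?_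
    · intro y
      obtain ⟨x, hx⟩ := D.red_surjective (E.red y)
      exact ⟨x, (hmem E _).1 (by
        rw [map_sub, sub_eq_zero, ← hx]; exact (f.red_toHom x).symm)⟩
    · intro x hx
      exact (hmem D x).1 (by rw [← f.red_toHom]; exact (hmem E _).2 hx)
  have hvb : Function.Bijective v := by
    refine bijective_of_nilpotent R.isNilpotent_max v ?_ ?_
    · intro y
      obtain ⟨x, hx⟩ := D.redMod_surjective (E.redMod y)
      exact ⟨x, (E.redMod_eq_zero_iff _).1 (by
        rw [map_sub, sub_eq_zero, ← hx]; exact (f.redMod_toHomMod x).symm)⟩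
    · intro x hx
      exact (D.redMod_eq_zero_iff x).1 (by
        rw [← f.redMod_toHomMod]; exact (E.redMod_eq_zero_iff _).2 hx)
  exact ⟨⟨AlgEquiv.ofBijective u hub, f.red_toHom, AddEquiv.ofBijective f.toHomMod hvb,
    f.toHomMod_smul, f.redMod_toHomMod⟩⟩

/-- The completeness conditions hold for every flat deformation when `A` is Noetherian and complete
and `M` is finite: the topology comes for free. -/
theorem complete_of_flat {A : Type u} [CommRing A] {I : Ideal A} [IsNoetherianRing A] [IsAdicComplete I A]
    {B : Type u} [CommRing B] [Algebra R B] (red : B →+* A) (hs : Function.Surjective red)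
    (hk : RingHom.ker red = R.max.map (algebraMap R B))
    {N M' : Type u} [AddCommGroup N] [Module R N] [Module B N] [IsScalarTower R B N]
    [AddCommGroup M'] [Module A M'] [Module.Finite A M'] (redMod : N →+ M')
    (hsmul : ∀ (b : B) (n : N), redMod (b • n) = red b • redMod n)
    (hsM : Function.Surjective redMod)
    (hkM : ∀ n : N, redMod n = 0 → n ∈ (R.max • ⊤ : Submodule R N)) :
    IsAdicComplete (I.comap red) N := by
  refine isAdicComplete_of_nilpotent_ker I red hs ?_ ?_ redMod hsmul hsM ?_
  · rw [hk]
    exact Ideal.FG.map (IsNoetherian.noetherian _) _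
  · obtain ⟨n, hn⟩ := R.isNilpotent_max
    exact ⟨n, by rw [hk, ← Ideal.map_pow, hn]; simp⟩
  · intro n hn
    have h := hkM n hn
    rw [hk]
    refine Submodule.smul_induction_on h ?_ ?_
    · intro r hr x _
      rw [← algebraMap_smul B r x]
      exact Submodule.smul_mem_smul (Ideal.mem_map_of_mem _ hr) trivial
    · exact fun a b ha hb => Submodule.add_mem _ ha hb


section BaseChange

attribute [local instance] Algebra.TensorProduct.rightAlgebra

/-- The base change `(S ⊗_R alg, S ⊗_R mod)` of a deformation along a morphism `R ⟶ S`
(the module is written as `(S ⊗_R alg) ⊗_alg mod`). -/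
noncomputable def baseChange [IsNoetherianRing A] [IsAdicComplete I A] [Module.Finite A M]
    (φ : R ⟶ S) (D : TopDef I M R) : TopDef I M S :=
  letI : Algebra R S := (ArtAlg.toAlgHom φ).toRingHom.toAlgebra
  letI : Algebra R A := (D.red.comp (algebraMap R D.alg)).toAlgebra
  have hφ : ∀ r : R, algebraMap R S r = ArtAlg.toAlgHom φ r := fun _ => rfl
  have res_comm : ∀ r : R, (algebraMap k A).comp (S.toBase : S →+* k) (algebraMap R S r) =
      algebraMap R A r := fun r => by
    change algebraMap k A (S.toBase (ArtAlg.toAlgHom φ r)) = D.red (algebraMap R D.alg r)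
    rw [ArtAlg.toBase_toAlgHom, D.red_algebraMap_eq]
  have scalar : ∀ s : S, ∃ r : R, s - algebraMap R S r ∈ S.max := fun s => by
    obtain ⟨c, hc⟩ := S.exists_scalar s
    exact ⟨algebraMap k R c, by rwa [hφ, AlgHom.commutes]⟩
  have max_le : ∀ r : R, r ∈ R.max → algebraMap R S r ∈ S.max :=
    fun r hr => ArtAlg.toAlgHom_mem_max φ hr
  let red : S ⊗[R] D.alg →+* A :=
    (Algebra.TensorProduct.lift
      (⟨(algebraMap k A).comp (S.toBase : S →+* k), res_comm⟩ : S →ₐ[R] A)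
      (⟨D.red, fun _ => rfl⟩ : D.alg →ₐ[R] A) (fun _ _ => Commute.all _ _)).toRingHom
  have red_tmul : ∀ (s : S) (b : D.alg), red (s ⊗ₜ b) = algebraMap k A (S.toBase s) * D.red b :=
    fun s b => Algebra.TensorProduct.lift_tmul _ _ _ s b
  let redMod : (S ⊗[R] D.alg) ⊗[D.alg] D.mod →+ M :=
    TensorProduct.liftAddHom
      ((((smulAddHom A M).comp red.toAddMonoidHom).flip.comp D.redMod).flip)
      (fun b z n => by
        change red (b • z) • D.redMod n = red z • D.redMod (b • n)
        rw [D.redMod_smul, smul_smul, Algebra.smul_def, map_mul,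
          Algebra.TensorProduct.right_algebraMap_apply, red_tmul]
        simp [mul_comm])
  have redMod_tmul : ∀ (b : S ⊗[R] D.alg) (n : D.mod), redMod (b ⊗ₜ n) = red b • D.redMod n :=
    fun b n => rfl
  have red_S : ∀ s : S, red (algebraMap S (S ⊗[R] D.alg) s) = algebraMap k A (S.toBase s) :=
    fun s => by
      rw [Algebra.TensorProduct.algebraMap_apply, red_tmul]; simp
  have red_alg : ∀ c : k, red (algebraMap S (S ⊗[R] D.alg) (algebraMap k S c)) = algebraMap k A c :=
    fun c => by rw [red_S, AlgHom.commutes]; rfl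
  have red_surj : Function.Surjective red := fun a => by
    obtain ⟨b, rfl⟩ := D.red_surjective a
    exact ⟨1 ⊗ₜ b, by rw [red_tmul]; simp⟩
  have toBase_max : ∀ s ∈ S.max, S.toBase s = 0 := fun s hs => by
    rw [← S.ker_toBase] at hs; exact hs
  have red_max : ∀ z ∈ S.max.map (algebraMap S (S ⊗[R] D.alg)), red z = 0 := fun z hz => by
    have : S.max.map (algebraMap S (S ⊗[R] D.alg)) ≤ RingHom.ker red :=
      Ideal.map_le_iff_le_comap.2 fun s hs => by
        rw [Ideal.mem_comap, RingHom.mem_ker, red_S, toBase_max s hs, map_zero]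
    exact this hz
  have approx : ∀ z : S ⊗[R] D.alg, ∃ b : D.alg,
      z - 1 ⊗ₜ b ∈ S.max.map (algebraMap S (S ⊗[R] D.alg)) := fun z => by
    induction z with
    | zero => exact ⟨0, by simp⟩
    | add x y hx hy =>
      obtain ⟨a, ha⟩ := hx
      obtain ⟨b, hb⟩ := hy
      refine ⟨a + b, ?_⟩
      rw [tmul_add, add_sub_add_comm]
      exact Ideal.add_mem _ ha hb
    | tmul s b =>
      obtain ⟨r, hr⟩ := scalar s
      refine ⟨r • b, ?_⟩
      have h1 : (1 : S) ⊗ₜ[R] (r • b) = (algebraMap R S r) ⊗ₜ[R] b := by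
        rw [← TensorProduct.smul_tmul, Algebra.smul_def, mul_one]
      have h2 : s ⊗ₜ[R] b - (algebraMap R S r) ⊗ₜ[R] b =
          algebraMap S (S ⊗[R] D.alg) (s - algebraMap R S r) * (1 ⊗ₜ b) := by
        rw [Algebra.TensorProduct.algebraMap_apply, Algebra.TensorProduct.tmul_mul_tmul,
          ← TensorProduct.sub_tmul]
        simp
      rw [h1, h2]
      exact Ideal.mul_mem_right _ _ (Ideal.mem_map_of_mem _ hr)
  have ker_red : RingHom.ker red = S.max.map (algebraMap S (S ⊗[R] D.alg)) := by
    refine le_antisymm (fun z hz => ?_) red_max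
    obtain ⟨b, hb⟩ := approx z
    have h1 : D.red b = 0 := by
      have h2 := red_max _ hb
      rw [map_sub, red_tmul, RingHom.mem_ker.1 hz] at h2
      simpa using h2
    have h3 : b ∈ R.max.map (algebraMap R D.alg) := by rw [← D.ker_red]; exact h1
    have h4 : (1 : S) ⊗ₜ[R] b ∈ S.max.map (algebraMap S (S ⊗[R] D.alg)) := by
      have h5 := Ideal.mem_map_of_mem (algebraMap D.alg (S ⊗[R] D.alg)) h3
      rw [Ideal.map_map] at h5
      refine Ideal.map_le_iff_le_comap.2 (fun r hr => ?_) h5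
      have h6 : (algebraMap D.alg (S ⊗[R] D.alg)) (algebraMap R D.alg r) =
          algebraMap S (S ⊗[R] D.alg) (algebraMap R S r) := by
        rw [← IsScalarTower.algebraMap_apply, ← IsScalarTower.algebraMap_apply]
      rw [Ideal.mem_comap, RingHom.comp_apply, h6]
      exact Ideal.mem_map_of_mem _ (max_le r hr)
    have := Ideal.add_mem _ hb h4
    rwa [sub_add_cancel] at this
  have redMod_smul : ∀ (b : S ⊗[R] D.alg) (n : (S ⊗[R] D.alg) ⊗[D.alg] D.mod),
      redMod (b • n) = red b • redMod n := fun b n => by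
    induction n with
    | zero => simp
    | add x y hx hy => rw [smul_add, map_add, hx, hy, map_add, smul_add]
    | tmul z n => rw [TensorProduct.smul_tmul', redMod_tmul, redMod_tmul, smul_eq_mul, map_mul,
        mul_smul]
  have redMod_surj : Function.Surjective redMod := fun m => by
    obtain ⟨n, rfl⟩ := D.redMod_surjective m
    exact ⟨1 ⊗ₜ n, by rw [redMod_tmul, map_one, one_smul]⟩
  have smul_mem : ∀ b ∈ S.max.map (algebraMap S (S ⊗[R] D.alg)),
      ∀ n : (S ⊗[R] D.alg) ⊗[D.alg] D.mod,
        b • n ∈ (S.max • ⊤ : Submodule S ((S ⊗[R] D.alg) ⊗[D.alg] D.mod)) := fun b hb n => by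
    refine Submodule.span_induction (p := fun b _ => ∀ n : (S ⊗[R] D.alg) ⊗[D.alg] D.mod,
        b • n ∈ (S.max • ⊤ : Submodule S ((S ⊗[R] D.alg) ⊗[D.alg] D.mod))) ?_ ?_ ?_ ?_ hb n
    · rintro _ ⟨s, hs, rfl⟩ n
      rw [algebraMap_smul]
      exact Submodule.smul_mem_smul hs trivial
    · intro n; simp
    · intro x y _ _ hx hy n
      rw [add_smul]; exact Submodule.add_mem _ (hx n) (hy n)
    · intro a x _ hx n
      rw [smul_eq_mul, mul_comm, mul_smul]; exact hx _
  have approxMod : ∀ z : (S ⊗[R] D.alg) ⊗[D.alg] D.mod, ∃ n : D.mod,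
      z - 1 ⊗ₜ n ∈ (S.max • ⊤ : Submodule S ((S ⊗[R] D.alg) ⊗[D.alg] D.mod)) := fun z => by
    induction z with
    | zero => exact ⟨0, by simp⟩
    | add x y hx hy =>
      obtain ⟨a, ha⟩ := hx
      obtain ⟨b, hb⟩ := hy
      refine ⟨a + b, ?_⟩
      rw [tmul_add, add_sub_add_comm]
      exact Submodule.add_mem _ ha hb
    | tmul z n =>
      obtain ⟨b, hb⟩ := approx z
      refine ⟨b • n, ?_⟩
      have h1 : (1 : S ⊗[R] D.alg) ⊗ₜ[D.alg] (b • n) = ((1 : S) ⊗ₜ[R] b) ⊗ₜ[D.alg] n := by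
        rw [← TensorProduct.smul_tmul, Algebra.smul_def, mul_one]; rfl
      have h2 : z ⊗ₜ[D.alg] n - ((1 : S) ⊗ₜ[R] b) ⊗ₜ[D.alg] n =
          (z - 1 ⊗ₜ b) • ((1 : S ⊗[R] D.alg) ⊗ₜ[D.alg] n) := by
        rw [TensorProduct.smul_tmul', smul_eq_mul, mul_one, TensorProduct.sub_tmul]
      rw [h1, h2]
      exact smul_mem _ hb _
  have redMod_max : ∀ n ∈ (S.max • ⊤ : Submodule S ((S ⊗[R] D.alg) ⊗[D.alg] D.mod)),
      redMod n = 0 := fun n hn => by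
    refine Submodule.smul_induction_on hn ?_ ?_
    · intro s hs x _
      rw [← algebraMap_smul (S ⊗[R] D.alg) s x, redMod_smul, red_S, toBase_max s hs]
      simp
    · intro x y hx hy
      rw [map_add, hx, hy, add_zero]
  have redMod_eq : ∀ n : (S ⊗[R] D.alg) ⊗[D.alg] D.mod,
      redMod n = 0 ↔ n ∈ (S.max • ⊤ : Submodule S ((S ⊗[R] D.alg) ⊗[D.alg] D.mod)) := fun z => by
    refine ⟨fun hz => ?_, redMod_max z⟩
    obtain ⟨n, hn⟩ := approxMod z
    have h1 : D.redMod n = 0 := by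
      have h2 := redMod_max _ hn
      rw [map_sub, redMod_tmul, hz] at h2
      simpa using h2
    have h4 : (1 : S ⊗[R] D.alg) ⊗ₜ[D.alg] n ∈
        (S.max • ⊤ : Submodule S ((S ⊗[R] D.alg) ⊗[D.alg] D.mod)) := by
      refine Submodule.smul_induction_on ((D.redMod_eq_zero_iff n).1 h1) ?_ ?_
      · intro r hr x _
        have h5 : (1 : S ⊗[R] D.alg) ⊗ₜ[D.alg] (r • x) =
            algebraMap R S r • ((1 : S ⊗[R] D.alg) ⊗ₜ[D.alg] x) := by
          rw [algebraMap_smul, TensorProduct.smul_tmul', ← algebraMap_smul D.alg r x,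
            ← TensorProduct.smul_tmul, algebraMap_smul]
        rw [h5]
        exact Submodule.smul_mem_smul (max_le r hr) trivial
      · intro x y hx hy
        rw [tmul_add]; exact Submodule.add_mem _ hx hy
    have := Submodule.add_mem _ hn h4
    rwa [sub_add_cancel] at this
  { alg := S ⊗[R] D.alg
    red := red
    red_algebraMap := red_alg
    red_surjective := red_surj
    ker_red := ker_red
    complete := complete_of_flat red red_surj ker_red red.toAddMonoidHom (fun b n => map_mul red b n)
      red_surj (fun n hn => by
        rw [Ideal.smul_top_eq_map, ← ker_red]; exact hn)
    mod := (S ⊗[R] D.alg) ⊗[D.alg] D.mod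
    flatMod := Module.Flat.of_linearEquiv
      (Algebra.IsPushout.cancelBaseChange R S D.alg (S ⊗[R] D.alg) D.mod)
    redMod := redMod
    redMod_smul := redMod_smul
    redMod_surjective := redMod_surj
    redMod_eq_zero_iff := redMod_eq
    completeMod := complete_of_flat red red_surj ker_red redMod redMod_smul
      redMod_surj (fun n hn => (redMod_eq n).1 hn) }

variable [IsNoetherianRing A] [IsAdicComplete I A] [Module.Finite A M]

/-- The canonical morphism from a deformation to its base change. -/
noncomputable def toBaseChange (φ : R ⟶ S) (D : TopDef I M R) : HomOver φ D (D.baseChange φ) :=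
  letI : Algebra R S := (ArtAlg.toAlgHom φ).toRingHom.toAlgebra
  { toHom := (Algebra.TensorProduct.includeRight : D.alg →ₐ[R] S ⊗[R] D.alg).toRingHom
    toHom_algebraMap := fun r =>
      ((Algebra.TensorProduct.includeRight : D.alg →ₐ[R] S ⊗[R] D.alg).commutes r).trans
        (IsScalarTower.algebraMap_apply R S (S ⊗[R] D.alg) r)
    red_toHom := fun b => by
      change algebraMap k A (S.toBase 1) * D.red b = D.red b
      simp
    toHomMod := (TensorProduct.mk D.alg (S ⊗[R] D.alg) D.mod 1).toAddMonoidHom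
    toHomMod_smul := fun b n => by
      change (1 : S ⊗[R] D.alg) ⊗ₜ[D.alg] (b • n) = ((1 : S) ⊗ₜ[R] b) • ((1 : S ⊗[R] D.alg) ⊗ₜ[D.alg] n)
      rw [← TensorProduct.smul_tmul, Algebra.smul_def, TensorProduct.smul_tmul']
      rfl
    redMod_toHomMod := fun n => by
      change (D.baseChange φ).red 1 • D.redMod n = D.redMod n
      rw [map_one, one_smul] }

/-- The universal property of the base change. -/
noncomputable def HomOver.desc {φ : R ⟶ S} {D : TopDef I M R} {E : TopDef I M S}
    (f : HomOver φ D E) : HomOver (𝟙 S) (D.baseChange φ) E :=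
  letI : Algebra R S := (ArtAlg.toAlgHom φ).toRingHom.toAlgebra
  letI : Algebra R E.alg := ((algebraMap S E.alg).comp (algebraMap R S)).toAlgebra
  haveI : IsScalarTower R S E.alg := IsScalarTower.of_algebraMap_eq fun _ => rfl
  let g : S ⊗[R] D.alg →+* E.alg :=
    (Algebra.TensorProduct.lift (Algebra.ofId S E.alg)
      (⟨f.toHom, f.toHom_algebraMap⟩ : D.alg →ₐ[R] E.alg) (fun _ _ => Commute.all _ _)).toRingHom
  have g_tmul : ∀ (s : S) (b : D.alg), g (s ⊗ₜ b) = algebraMap S E.alg s * f.toHom b :=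
    fun s b => Algebra.TensorProduct.lift_tmul _ _ _ s b
  have g_red : ∀ z, E.red (g z) = (D.baseChange φ).red z := fun z => by
    induction z with
    | zero =>
      rw [map_zero, map_zero]; exact (map_zero (D.baseChange φ).red).symm
    | add x y hx hy => rw [map_add, map_add, hx, hy]; exact (map_add (D.baseChange φ).red x y).symm
    | tmul s b =>
      rw [g_tmul, map_mul, f.red_toHom, E.red_algebraMap_eq]; rfl
  let h : (S ⊗[R] D.alg) ⊗[D.alg] D.mod →+ E.mod :=
    TensorProduct.liftAddHom
      ((((smulAddHom E.alg E.mod).comp g.toAddMonoidHom).flip.comp f.toHomMod).flip)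
      (fun b z n => by
        change g (b • z) • f.toHomMod n = g z • f.toHomMod (b • n)
        rw [f.toHomMod_smul, smul_smul, Algebra.smul_def, map_mul,
          Algebra.TensorProduct.right_algebraMap_apply, g_tmul]
        simp [mul_comm])
  have h_tmul : ∀ (b : S ⊗[R] D.alg) (n : D.mod), h (b ⊗ₜ n) = g b • f.toHomMod n :=
    fun b n => rfl
  { toHom := g
    toHom_algebraMap := fun s => by
      change g (s ⊗ₜ 1) = algebraMap S E.alg s
      rw [g_tmul, map_one, mul_one]
    red_toHom := g_red
    toHomMod := h
    toHomMod_smul := fun (b : S ⊗[R] D.alg) (n : (S ⊗[R] D.alg) ⊗[D.alg] D.mod) => by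
      change h (b • n) = g b • h n
      induction n with
      | zero => simp
      | add x y hx hy => rw [smul_add, map_add, hx, hy, map_add, smul_add]
      | tmul z n => rw [TensorProduct.smul_tmul', h_tmul, h_tmul, smul_eq_mul, map_mul, mul_smul]
    redMod_toHomMod := fun (n : (S ⊗[R] D.alg) ⊗[D.alg] D.mod) => by
      induction n with
      | zero => exact (map_zero E.redMod).trans (map_zero (D.baseChange φ).redMod).symm
      | add x y hx hy =>
        exact (congrArg E.redMod (map_add h x y)).trans ((map_add E.redMod _ _).trans
          ((congrArg₂ (· + ·) hx hy).trans (map_add (D.baseChange φ).redMod x y).symm))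
      | tmul z n =>
        change E.redMod (g z • f.toHomMod n) = (D.baseChange φ).red z • D.redMod n
        rw [E.redMod_smul, f.redMod_toHomMod, g_red] }

/-- Any deformation receiving a morphism over `φ` is isomorphic to the base change along `φ`. -/
theorem HomOver.baseChange_iso {φ : R ⟶ S} {D : TopDef I M R} {E : TopDef I M S}
    (f : HomOver φ D E) : Nonempty (Iso (D.baseChange φ) E) :=
  f.desc.nonempty_iso

end BaseChange

end TopDef

/-- The functor `Def^top_{A,M} : Art_k → Ens` that maps `R` to the set of isomorphism classes of
topological deformations of the pair `(A, M)` over `R`, and a morphism to the base change. -/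
noncomputable def defTop [IsNoetherianRing A] [IsAdicComplete I A] [Module.Finite A M] :
    ArtAlg k ⥤ Type (u + 1) where
  obj R := Quotient (TopDef.isoSetoid (k := k) I M R)
  map {R S} φ := ↾(Quotient.map (TopDef.baseChange φ) fun D E ⟨e⟩ => by
    have f : TopDef.HomOver (𝟙 R ≫ φ) D (E.baseChange φ) := (E.toBaseChange φ).comp e.homOver
    rw [Category.id_comp] at f
    exact f.baseChange_iso)
  map_id R := by
    ext D
    induction D using Quotient.inductionOn with
    | h D => exact Quotient.sound ((Setoid.refl D).elim fun e => e.homOver.baseChange_iso)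
  map_comp φ ψ := by
    ext D
    induction D using Quotient.inductionOn with
    | h D =>
      exact Quotient.sound
        ((((D.baseChange φ).toBaseChange ψ).comp (D.toBaseChange φ)).baseChange_iso)

end Deformations

/-- A module `M` over a ring `A` has generic rank `1` if `K ⊗_A M` is free of rank `1` over the
total ring of fractions `K` of `A`. -/
def HasGenericRankOne (A : Type u) [CommRing A] (M : Type v) [AddCommGroup M] [Module A M] : Prop :=
  Nonempty (FractionRing A ⊗[A] M ≃ₗ[FractionRing A] FractionRing A)

section PlaneCurve

open MvPowerSeries

variable {k : Type u} [Field k]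

/-- The ring `A = k[[x,y]]/(f)`. -/
abbrev PlaneCurve (f : MvPowerSeries (Fin 2) k) : Type u :=
  MvPowerSeries (Fin 2) k ⧸ Ideal.span {f}

/-- The ideal of `A = k[[x,y]]/(f)` generated by the classes of `x` and `y`, which defines the
topology of `A`. -/
noncomputable abbrev PlaneCurve.ideal (f : MvPowerSeries (Fin 2) k) : Ideal (PlaneCurve f) :=
  (Ideal.span (Set.range (X : Fin 2 → MvPowerSeries (Fin 2) k))).map
    (algebraMap (MvPowerSeries (Fin 2) k) (PlaneCurve f))

instance PlaneCurve.isAdicComplete (f : MvPowerSeries (Fin 2) k) :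
    IsAdicComplete (PlaneCurve.ideal f) (PlaneCurve f) := by
  rw [IsAdicComplete.map_algebraMap_iff]
  have h1 : IsPrecomplete (Ideal.span (Set.range (X : Fin 2 → MvPowerSeries (Fin 2) k)))
      (PlaneCurve f) :=
    isPrecomplete_of_finite _ _
  have h2 : IsHausdorff (Ideal.span (Set.range (X : Fin 2 → MvPowerSeries (Fin 2) k)))
      (PlaneCurve f) :=
    IsHausdorff.of_le_jacobson _ _ (IsAdicComplete.le_jacobson_bot _)
  exact ⟨⟩

end PlaneCurve

end FormalDef

/-!
# Formal smoothness of the deformations of a plane curve with a torsion-free module of rank one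

Deforming the curve together with the module amounts to deforming a square matrix, and there is no
obstruction to lifting the entries of a matrix.

Let `O = k[[x,y]]`. A torsion-free module `M` of generic rank one over `A = O/(f)` is an ideal of
`A` containing a nonzerodivisor (`exists_embedding_of_hasGenericRankOne`). As `O` is regular of
dimension two, the relations between generators of `M` form a free `O`-module
(`exists_square_presentation`), so `M` is the cokernel of an injective square matrix `Φ` over `O`.
Since `M` has rank one, `det Φ` generates `(f)` (`span_det_eq`): the matrix determines the curve.
The hypothesis on the partial derivatives enters through `f ≠ 0`.

Let `D` be a deformation of `(A, M)` over an Artinian algebra `S`. Completeness gives a homomorphism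
`S ⊗ O → D.alg`, and flatness allows `Φ` to be lifted to a matrix `Ψ` of relations between lifts of
the generators. Then `det Ψ` kills `D.mod` by Cramer's rule. An element `m` of `M` with zero
annihilator lifts to an element of `D.mod` with zero annihilator, by flatness
(`injective_and_flat_of_reduction`), so `det Ψ` vanishes in `D.alg` (`TopDef.exists_matrix`).

For a surjection `R → S`, lift the entries of `Ψ` to a matrix `Ψ'` over `R ⊗ O`. The quotient by
`det Ψ'` and the cokernel of `Ψ'` are flat, because `det Φ` and `Φ` are injective, and they form a
deformation of `(A, M)` over `R` (`TopDef.ofMatrix`). It maps to `D`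
(`TopDef.ofMatrix_nonempty_homOver`), and a deformation mapping to `D` over `R → S` has base change
isomorphic to `D`.
-/

namespace FormalDef

open CategoryTheory TensorProduct

/-! ### Square presentations over a two-dimensional regular local ring -/

section RegularTwoDimensional

open IsLocalRing
open scoped Pointwise

theorem isPrincipalIdealRing_quotient {O : Type*} [CommRing O] [IsNoetherianRing O]
    [IsLocalRing O] {x y : O} (hx : Prime x)
    (hm : maximalIdeal O = Ideal.span {x, y}) : IsPrincipalIdealRing (O ⧸ Ideal.span {x}) := by
  have : (Ideal.span {x}).IsPrime := (Ideal.span_singleton_prime hx.ne_zero).2 hx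
  have : IsLocalRing (O ⧸ Ideal.span {x}) :=
    .of_surjective' (Ideal.Quotient.mk _) Ideal.Quotient.mk_surjective
  refine ((tfae_of_isNoetherianRing_of_isLocalRing_of_isDomain (O ⧸ Ideal.span {x})).out 0 4).2 ?_
  have h : maximalIdeal (O ⧸ Ideal.span {x}) =
      (maximalIdeal O).map (Ideal.Quotient.mk (Ideal.span {x})) := by
    rw [← IsLocalRing.map_maximalIdeal_of_surjective _ Ideal.Quotient.mk_surjective]
  rw [h, hm, Ideal.map_span, Set.image_pair, Ideal.Quotient.eq_zero_iff_mem.2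
    (Ideal.mem_span_singleton_self x), Ideal.span_insert_zero]
  exact ⟨⟨_, rfl⟩⟩

variable {O : Type*} [CommRing O] [IsDomain O] [IsNoetherianRing O] [IsLocalRing O]

/-- The kernel `K` of a linear form `O ^ n → O` over a regular local ring of dimension two is free:
`O ⧸ (x)` is a principal ideal domain, and `K / x K` embeds in `(O ⧸ (x)) ^ n` because the image of
the form has no `x`-torsion. -/
theorem free_ker {x y : O} (hx : Prime x) (hm : maximalIdeal O = Ideal.span {x, y})
    {n : ℕ} (g : (Fin n → O) →ₗ[O] O) : Module.Free O (LinearMap.ker g) := by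
  have hxm : x ∈ maximalIdeal O := hm ▸ Ideal.subset_span (by simp)
  have : (Ideal.span {x}).IsPrime := (Ideal.span_singleton_prime hx.ne_zero).2 hx
  have := isPrincipalIdealRing_quotient hx hm
  have hreg : IsSMulRegular O x := fun a b h => mul_left_cancel₀ hx.ne_zero h
  have hregK : IsSMulRegular (LinearMap.ker g) x := fun a b h =>
    Subtype.ext (funext fun i => hreg (congrFun (congrArg Subtype.val h) i))
  have : Module.FinitePresentation O (LinearMap.ker g) :=
    Module.finitePresentation_of_finite O _
  rw [← Module.free_quotSMulTop_iff_free O _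
    (by rwa [IsLocalRing.jacobson_eq_maximalIdeal _ bot_ne_top]) hregK]
  let u : QuotSMulTop x (LinearMap.ker g) →ₗ[O ⧸ Ideal.span {x}] QuotSMulTop x (Fin n → O) :=
    (QuotSMulTop.map x (LinearMap.ker g).subtype).extendScalarsOfSurjective
      Ideal.Quotient.mk_surjective
  have hu : Function.Injective u := by
    rw [injective_iff_map_eq_zero]
    intro z hz
    obtain ⟨a, rfl⟩ := Submodule.mkQ_surjective _ z
    have h1 : (a : Fin n → O) ∈ (x • ⊤ : Submodule O (Fin n → O)) :=
      (Submodule.Quotient.mk_eq_zero _).1 hz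
    obtain ⟨b, -, hb⟩ := (Submodule.mem_smul_pointwise_iff_exists _ _ _).1 h1
    -- the image of `g` has no `x`-torsion, so `b` is a syzygy if `x • b` is one
    have hgb : g b = 0 := hreg (by
      change x • g b = x • (0 : O)
      rw [← map_smul, hb, smul_zero]; exact a.2)
    refine (Submodule.Quotient.mk_eq_zero _).2
      ((Submodule.mem_smul_pointwise_iff_exists _ _ _).2 ⟨⟨b, hgb⟩, trivial, Subtype.ext hb⟩)
  have := Module.Finite.of_restrictScalars_finite O (O ⧸ Ideal.span {x})
    (QuotSMulTop x (Fin n → O))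
  exact Module.Free.of_equiv (LinearEquiv.ofInjective u hu).symm

/-- The vectors `v` with `f ∣ ∑ i, v i * g i`, which are the relations between the classes of the
`g i` in `O ⧸ (f)`, form a free module of rank `n`. Indeed they are the projections of the syzygies
of the `n + 1` elements `f, g 0, …, g (n - 1)`, and such a syzygy is determined by its projection. -/
theorem exists_square_presentation {x y : O} (hx : Prime x)
    (hm : maximalIdeal O = Ideal.span {x, y}) {n : ℕ} (g : Fin n → O) {f : O} (hf : f ≠ 0) :
    ∃ Φ : Matrix (Fin n) (Fin n) O, (∀ c, Φ.mulVec c = 0 → c = 0) ∧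
      ∀ v : Fin n → O, f ∣ ∑ i, v i * g i ↔ ∃ c, Φ.mulVec c = v := by
  let p : (Fin (n + 1) → O) →ₗ[O] O := Fintype.linearCombination O (Fin.cons f g : Fin (n + 1) → O)
  have hp : ∀ v, p v = v 0 * f + ∑ i : Fin n, v i.succ * g i := fun v => by
    simp [p, Fintype.linearCombination_apply, Fin.sum_univ_succ]
  have := free_ker hx hm p
  have hrange : Module.finrank O (LinearMap.range p) = 1 := by
    have h1 : Nontrivial (LinearMap.range p) := by
      refine ⟨⟨⟨f, Pi.single 0 1, ?_⟩, 0, fun h => hf (congrArg Subtype.val h)⟩⟩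
      rw [hp]; simp
    have h2 := Module.finrank_pos (R := O) (M := LinearMap.range p)
    have h3 := Submodule.finrank_le (LinearMap.range p)
    rw [Module.finrank_self] at h3
    omega
  have hker : Module.finrank O (LinearMap.ker p) = n := by
    have := Submodule.finrank_quotient_add_finrank (LinearMap.ker p)
    rw [p.quotKerEquivRange.finrank_eq, Module.finrank_fin_fun, hrange] at this
    omega
  let b := Module.finBasisOfFinrankEq O (LinearMap.ker p) hker
  let Φ : Matrix (Fin n) (Fin n) O := Matrix.of fun i j => (b j : Fin (n + 1) → O) i.succ
  have hΦ : ∀ c i, Φ.mulVec c i = ((b.equivFun.symm c : LinearMap.ker p) : Fin (n + 1) → O) i.succ :=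
    fun c i => by
      simp [Φ, Matrix.mulVec, dotProduct, Module.Basis.equivFun_symm_apply, mul_comm]
  refine ⟨Φ, fun c hc => ?_, fun v => ⟨?_, ?_⟩⟩
  · have h1 := (b.equivFun.symm c).2
    have h2 : ∀ i : Fin n, ((b.equivFun.symm c : LinearMap.ker p) : Fin (n + 1) → O) i.succ = 0 :=
      fun i => by rw [← hΦ, hc]; rfl
    rw [LinearMap.mem_ker, hp] at h1
    simp only [h2, zero_mul, Finset.sum_const_zero, add_zero, mul_eq_zero, hf, or_false] at h1
    have h3 : b.equivFun.symm c = 0 := Subtype.ext (funext fun i => Fin.cases h1 h2 i)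
    exact b.equivFun.symm.map_eq_zero_iff.1 h3
  · rintro ⟨a, ha⟩
    have h1 : (Fin.cons (-a) v : Fin (n + 1) → O) ∈ LinearMap.ker p := by
      rw [LinearMap.mem_ker, hp]
      simp only [Fin.cons_zero, Fin.cons_succ, ha]
      ring
    refine ⟨b.equivFun ⟨_, h1⟩, funext fun i => ?_⟩
    rw [hΦ, LinearEquiv.symm_apply_apply]
    exact Fin.cons_succ (α := fun _ => O) (-a) v i
  · rintro ⟨c, rfl⟩
    have h1 := (b.equivFun.symm c).2
    rw [LinearMap.mem_ker, hp] at h1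
    simp only [hΦ]
    exact ⟨-((b.equivFun.symm c : LinearMap.ker p) : Fin (n + 1) → O) 0, by
      linear_combination h1⟩

end RegularTwoDimensional

/-! ### The determinant of a square presentation -/

section Determinant

open Matrix

variable {O : Type*} [CommRing O] [IsDomain O] {n : ℕ}

/-- If the columns of `Φ` generate the relations between the classes of the `g i` in `O ⧸ (f)`, and
some linear combination `s = ∑ i, w i * g i` is a nonzerodivisor modulo `f`, then `det Φ` generates
`(f)`. By Cramer's rule `f` divides `det Φ * s`, hence `det Φ`. Conversely `det Φ` divides both
`f ^ n`, as `f` kills the module, and `s ^ n * f`, which is the determinant of other relations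
between the `g i` and `s`; as `s` is a nonzerodivisor modulo `f`, this forces `det Φ / f` to be
a unit. -/
theorem span_det_eq {f : O} (hf : f ≠ 0) {g : Fin n → O} {Φ : Matrix (Fin n) (Fin n) O}
    (hΦ : ∀ v : Fin n → O, f ∣ ∑ i, v i * g i ↔ ∃ c, Φ.mulVec c = v) {w : Fin n → O}
    (hw : ∀ a, f ∣ (∑ i, w i * g i) * a → f ∣ a) :
    Ideal.span {Φ.det} = Ideal.span {f} := by
  set s := ∑ i, w i * g i with hs
  have hdet : f ∣ Φ.det := by
    refine hw _ ?_
    have h := (hΦ (Φ.det • w)).2 ⟨Φ.adjugate *ᵥ w, by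
      rw [mulVec_mulVec, mul_adjugate, smul_mulVec, one_mulVec]⟩
    simp only [Pi.smul_apply, smul_eq_mul, mul_assoc] at h
    rwa [← Finset.mul_sum, mul_comm] at h
  -- it remains to show that `u` is a unit
  obtain ⟨u, hu⟩ := hdet
  have hf1 : ∀ i : Fin n, ∃ c, Φ *ᵥ c = f • Pi.single i (1 : O) := fun i => (hΦ _).1
    ⟨g i, by simp [Pi.single_apply]⟩
  choose Ψ hΨ using hf1
  have hΨ' : Φ * (Matrix.of Ψ)ᵀ = f • 1 := by
    ext i j
    have := congrFun (hΨ j) i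
    simpa [Matrix.mul_apply, mulVec, dotProduct, Matrix.one_apply, Pi.single_apply] using this
  -- `f` kills the module, so `Φ` divides `f • 1` on the left
  have hpow : f * u * (Matrix.of Ψ).det = f ^ n := by
    have := congrArg det hΨ'
    rw [det_mul, det_transpose, det_smul, det_one, mul_one, Fintype.card_fin, hu] at this
    exact this
  have hB : ∀ j : Fin n, ∃ c, Φ *ᵥ c = s • Pi.single j (1 : O) - g j • w := fun j => (hΦ _).1
    ⟨0, by
      simp only [Pi.sub_apply, Pi.smul_apply, Pi.single_apply, smul_eq_mul, mul_ite, mul_one,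
        mul_zero, sub_mul, ite_mul, zero_mul, Finset.sum_sub_distrib, Finset.sum_ite_eq',
        Finset.mem_univ, if_true, mul_assoc]
      rw [← Finset.mul_sum, ← hs]; ring⟩
  choose B hB using hB
  obtain ⟨F, hF⟩ : ∃ F, Φ *ᵥ F = f • w := (hΦ _).1 ⟨s, by
    simp [hs, Finset.mul_sum, mul_assoc]⟩
  -- The module is presented on the generators and their combination with coefficients `w` by the
  -- first factor; the right-hand side expresses other relations between the same generators.
  have hblock : fromBlocks Φ (replicateCol Unit w) 0 (-1) *
      fromBlocks (Matrix.of B)ᵀ (replicateCol Unit F) (replicateRow Unit g) (-(f • 1)) =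
      fromBlocks (s • 1) 0 (-replicateRow Unit g) (f • 1) := by
    rw [fromBlocks_multiply]
    congr 1
    · ext i j
      have := congrFun (hB j) i
      simp only [mulVec, dotProduct, Pi.sub_apply, Pi.smul_apply, Pi.single_apply,
        smul_eq_mul] at this
      simp [Matrix.mul_apply, this, Matrix.one_apply, mul_comm]
    · ext i j
      have := congrFun hF i
      simp only [mulVec, dotProduct, Pi.smul_apply, smul_eq_mul] at this
      simp [Matrix.mul_apply, this]
    · simp
    · simp
  have hsn : s ^ n = u * -(fromBlocks (Matrix.of B)ᵀ (replicateCol Unit F) (replicateRow Unit g)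
      (-(f • 1))).det := by
    have h := congrArg det hblock
    rw [det_mul, det_fromBlocks_zero₂₁, det_fromBlocks_zero₁₂, det_smul, det_smul, hu] at h
    simp only [det_one, Fintype.card_fin, Fintype.card_unit, det_neg, pow_one, mul_one] at h
    refine mul_left_cancel₀ hf ?_
    linear_combination -h
  -- a nonzerodivisor modulo `f` is one modulo every power of `f`
  have hwpow : ∀ (i j : ℕ) (a : O), f ^ i ∣ s ^ j * a → f ^ i ∣ a := by
    have h1 : ∀ (j : ℕ) (a : O), f ∣ s ^ j * a → f ∣ a := by
      intro j
      induction j with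
      | zero => simp
      | succ j ih => intro a h; exact ih a (hw _ (by rwa [pow_succ', mul_assoc] at h))
    intro i j
    induction i with
    | zero => simp
    | succ i ih =>
      intro a h
      obtain ⟨b, rfl⟩ := h1 j a ((Dvd.intro_left _ (pow_succ f i).symm).trans h)
      rw [pow_succ', mul_left_comm] at h
      rw [pow_succ']
      exact mul_dvd_mul_left f (ih b ((mul_dvd_mul_iff_left hf).1 h))
  obtain ⟨v, hv⟩ : f ^ n ∣ f * (Matrix.of Ψ).det := hwpow n n _
    ⟨-(fromBlocks (Matrix.of B)ᵀ (replicateCol Unit F) (replicateRow Unit g) (-(f • 1))).det, by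
      rw [hsn, ← hpow]; ring⟩
  have huv : u * v = 1 := by
    refine mul_left_cancel₀ (pow_ne_zero n hf) ?_
    calc f ^ n * (u * v) = u * (f ^ n * v) := by ring
      _ = f ^ n * 1 := by rw [← hv, mul_one, ← hpow]; ring
  rw [hu, Ideal.span_singleton_mul_right_unit (IsUnit.of_mul_eq_one v huv)]

end Determinant

/-! ### Modules of generic rank one as ideals -/

section RankOne

/-- A finite torsion-free module of generic rank one is isomorphic to an ideal that contains a
nonzerodivisor. -/
theorem exists_embedding_of_hasGenericRankOne {A : Type u} [CommRing A]
    {M : Type v} [AddCommGroup M] [Module A M] [Module.Finite A M] [Module.IsTorsionFree A M]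
    (h : HasGenericRankOne A M) :
    ∃ ι : M →ₗ[A] A, Function.Injective ι ∧ ∃ m, ι m ∈ nonZeroDivisors A := by
  obtain ⟨e⟩ := h
  let ψ : M →ₗ[A] FractionRing A :=
    (e.toLinearMap.restrictScalars A).comp (TensorProduct.mk A (FractionRing A) M 1)
  have hψ : Function.Injective ψ := by
    rw [injective_iff_map_eq_zero]
    intro m hm
    have h0 : TensorProduct.mk A (FractionRing A) M 1 m = 0 := by
      simpa [ψ] using hm
    obtain ⟨c, hc⟩ := (IsLocalizedModule.eq_zero_iff (nonZeroDivisors A)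
      (TensorProduct.mk A (FractionRing A) M 1)).1 h0
    have : IsSMulRegular M (c : A) := Module.IsTorsionFree.isSMulRegular
      (isRegular_iff_mem_nonZeroDivisors.2 c.2)
    exact this.right_eq_zero_of_smul hc
  obtain ⟨S, hS⟩ := Module.Finite.fg_top (R := A) (M := M)
  classical
  obtain ⟨⟨b, hb⟩, hbS⟩ := IsLocalization.exist_integer_multiples_of_finset (nonZeroDivisors A)
    (S.image ψ)
  have hint : ∀ m, ∃ a, algebraMap A (FractionRing A) a = b • ψ m := by
    intro m
    have : m ∈ Submodule.span A (S : Set M) := by rw [hS]; trivial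
    induction this using Submodule.span_induction with
    | mem x hx => exact hbS _ (Finset.mem_image_of_mem _ hx)
    | zero => exact ⟨0, by simp⟩
    | add x y _ _ hx hy =>
      obtain ⟨a, ha⟩ := hx
      obtain ⟨c, hc⟩ := hy
      exact ⟨a + c, by rw [map_add, map_add, ha, hc, smul_add]⟩
    | smul r x _ hx =>
      obtain ⟨a, ha⟩ := hx
      exact ⟨r * a, by rw [map_mul, ha, map_smul, smul_comm, Algebra.smul_def r]⟩
  choose ι hι using hint
  have hinj := IsFractionRing.injective A (FractionRing A)
  have hreg : ∀ z : FractionRing A, b • z = 0 → z = 0 := fun z hz => by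
    rw [Algebra.smul_def] at hz
    exact ((IsLocalization.map_units (FractionRing A) (⟨b, hb⟩ : nonZeroDivisors A)).mul_right_eq_zero).1 hz
  refine ⟨⟨⟨ι, fun x y => hinj ?_⟩, fun r x => hinj ?_⟩, ?_, ?_⟩
  · rw [map_add, hι, hι, hι, map_add, smul_add]
  · rw [hι, map_smul, smul_comm, ← hι, RingHom.id_apply, smul_eq_mul, map_mul, Algebra.smul_def]
  · rw [injective_iff_map_eq_zero]
    intro m hm
    refine hψ ?_
    rw [map_zero]
    exact hreg _ (by rw [← hι]; exact (congrArg _ hm).trans (map_zero _))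
  · obtain ⟨⟨m, t⟩, hm⟩ := IsLocalizedModule.surj (nonZeroDivisors A)
      (TensorProduct.mk A (FractionRing A) M 1) (e.symm 1)
    refine ⟨m, ?_⟩
    have h1 : ψ m = algebraMap A (FractionRing A) t := by
      have h2 : ψ m = e ((t : A) • e.symm 1) := congrArg e hm.symm
      rw [h2, ← algebraMap_smul (FractionRing A) (t : A) (e.symm 1), map_smul]
      simp
    have h3 : ι m = b * t := hinj (by rw [hι, h1, map_mul, Algebra.smul_def])
    change ι m ∈ _
    rw [h3]
    exact mul_mem hb t.2

end RankOne

/-! ### The ring of power series in two variables -/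

section PowerSeriesRing

open MvPowerSeries IsLocalRing

variable {k : Type*} [Field k]

instance isDomain_mvPowerSeries (σ : Type*) : IsDomain (MvPowerSeries σ k) :=
  NoZeroDivisors.to_isDomain _

theorem mem_span_X_of_constantCoeff_eq_zero {R : Type*} [CommRing R]
    {g : MvPowerSeries (Fin 2) R} (hg : constantCoeff g = 0) :
    g ∈ Ideal.span {(X 0 : MvPowerSeries (Fin 2) R), X 1} := by
  classical
  let h : MvPowerSeries (Fin 2) R := fun m => if m 0 = 0 then coeff m g else 0
  have hcoeff : ∀ m, coeff m h = if m 0 = 0 then coeff m g else 0 := fun _ => rfl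
  obtain ⟨a, ha⟩ : X 0 ∣ g - h := X_dvd_iff.2 fun m hm => by
    rw [map_sub, hcoeff, if_pos hm, sub_self]
  obtain ⟨b, hb⟩ : X 1 ∣ h := X_dvd_iff.2 fun m hm => by
    rw [hcoeff]
    split_ifs with h0
    · have : m = 0 := Finsupp.ext fun i => by fin_cases i <;> assumption
      rw [this, coeff_zero_eq_constantCoeff_apply, hg]
    · rfl
  refine Ideal.mem_span_pair.2 ⟨a, b, ?_⟩
  linear_combination -ha - hb

theorem maximalIdeal_eq_span_X :
    maximalIdeal (MvPowerSeries (Fin 2) k) = Ideal.span {X 0, X 1} := by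
  refine le_antisymm (fun g hg => mem_span_X_of_constantCoeff_eq_zero ?_) ?_
  · by_contra h
    exact (mem_maximalIdeal _).1 hg (isUnit_iff_constantCoeff.2 (isUnit_iff_ne_zero.2 h))
  · rw [Ideal.span_le]
    rintro _ (rfl | rfl) <;>
    · refine (mem_maximalIdeal _).2 fun h => ?_
      simpa using isUnit_iff_constantCoeff.1 h

theorem prime_X_zero : Prime (X 0 : MvPowerSeries (Fin 2) k) := by
  rw [← MulEquiv.prime_iff (finSuccEquiv k 1).toMulEquiv]
  have : (finSuccEquiv k 1).toMulEquiv (X 0) = PowerSeries.X := finSuccEquiv_X_zero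
  rw [this]
  exact PowerSeries.X_prime

theorem not_finite_mvPowerSeries : ¬ Module.Finite k (MvPowerSeries (Fin 2) k) := fun _ => by
  have : IsArtinianRing (MvPowerSeries (Fin 2) k) := IsArtinianRing.of_finite k _
  have h : IsField (MvPowerSeries (Fin 2) k) := IsArtinianRing.isField_of_isDomain _
  obtain ⟨y, hy⟩ := h.mul_inv_cancel prime_X_zero.ne_zero
  exact prime_X_zero.not_isUnit (IsUnit.of_mul_eq_one y hy)

/-- Polynomials are dense in the power series ring. -/
theorem exists_polynomial_sub_mem_pow (g : MvPowerSeries (Fin 2) k) (n : ℕ) :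
    ∃ p : MvPolynomial (Fin 2) k, g - (p : MvPowerSeries (Fin 2) k) ∈
      (Ideal.span (Set.range (X : Fin 2 → MvPowerSeries (Fin 2) k))) ^ n := by
  induction n generalizing g with
  | zero => exact ⟨0, by simp⟩
  | succ n ih =>
    obtain ⟨a, b, hab⟩ := Ideal.mem_span_pair.1 (mem_span_X_of_constantCoeff_eq_zero
      (g := g - C (constantCoeff g)) (by simp))
    obtain ⟨p, hp⟩ := ih a
    obtain ⟨q, hq⟩ := ih b
    refine ⟨MvPolynomial.C (constantCoeff g) + p * MvPolynomial.X 0 + q * MvPolynomial.X 1, ?_⟩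
    have h : g - ((MvPolynomial.C (constantCoeff g) + p * MvPolynomial.X 0 +
        q * MvPolynomial.X 1 : MvPolynomial (Fin 2) k) : MvPowerSeries (Fin 2) k) =
        (a - (p : MvPowerSeries (Fin 2) k)) * X 0 + (b - (q : MvPowerSeries (Fin 2) k)) * X 1 := by
      push_cast
      linear_combination -hab
    rw [h, pow_succ]
    exact add_mem (Ideal.mul_mem_mul hp (Ideal.subset_span ⟨0, rfl⟩))
      (Ideal.mul_mem_mul hq (Ideal.subset_span ⟨1, rfl⟩))

/-- Power series can be evaluated at elements of an ideal for which the target is adically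
complete. -/
theorem exists_algHom_of_isAdicComplete {k B : Type*} [CommRing k] [CommRing B] [Algebra k B]
    {σ : Type*} [Finite σ] (J : Ideal B)
    [IsAdicComplete J B] (a : σ → B) (ha : ∀ i, a i ∈ J) :
    ∃ l : MvPowerSeries σ k →+* B,
      ∀ p : MvPolynomial σ k, l p = MvPolynomial.aeval a p := by
  algebraize [(MvPolynomial.aeval a : MvPolynomial σ k →ₐ[k] B).toRingHom]
  have halg : ∀ p, algebraMap (MvPolynomial σ k) B p = MvPolynomial.aeval a p := fun _ => rfl
  have hJ : ∀ n, ∀ p ∈ MvPolynomial.idealOfVars σ k ^ n,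
      algebraMap (MvPolynomial σ k) B p ∈ J ^ n := by
    intro n p hp
    have h1 : (MvPolynomial.idealOfVars σ k).map (algebraMap (MvPolynomial σ k) B) ≤ J := by
      rw [MvPolynomial.idealOfVars, Ideal.map_span, Ideal.span_le]
      rintro _ ⟨_, ⟨i, rfl⟩, rfl⟩
      rw [halg, MvPolynomial.aeval_X]
      exact ha i
    have h2 := Ideal.mem_map_of_mem (algebraMap (MvPolynomial σ k) B) hp
    rw [Ideal.map_pow] at h2
    exact Ideal.pow_right_mono h1 n h2
  let F : ∀ n, MvPowerSeries σ k →ₐ[MvPolynomial σ k] B ⧸ J ^ n := fun n =>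
    (Ideal.Quotient.liftₐ (MvPolynomial.idealOfVars σ k ^ n) (Algebra.ofId _ (B ⧸ J ^ n))
      fun p hp => Ideal.Quotient.eq_zero_iff_mem.2 (hJ n p hp)).comp (truncTotalAlgHom σ k n)
  have hF : ∀ n g, F n g = Ideal.Quotient.mk (J ^ n)
      (algebraMap (MvPolynomial σ k) B (truncTotal n g)) := fun n g => rfl
  -- truncate a power series in total degree `n` to evaluate it modulo `J ^ n`
  let l := IsAdicComplete.liftAlgHom J F (fun {m n} hle => AlgHom.ext fun g => by
    change Ideal.Quotient.factor (Ideal.pow_le_pow_right hle) (F n g) = F m g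
    rw [hF, hF, Ideal.Quotient.factor_mk, Ideal.Quotient.eq, ← map_sub]
    exact hJ m _ (truncTotal_sub_truncTotal_mem_pow_idealOfVars hle le_rfl g))
  exact ⟨l, fun p => l.commutes p⟩

/-- A homomorphism `q` from the power series ring to `A`, sending the variables to `I`, lifts along
any surjection `π : B → A` for which `B` is complete with respect to the inverse image of `I`. -/
theorem exists_lift_of_isAdicComplete {A B : Type*} [CommRing A] [CommRing B] [Algebra k B]
    (I : Ideal A) [IsHausdorff I A] (π : B →+* A) (hπ : Function.Surjective π)
    [IsAdicComplete (I.comap π) B] (q : MvPowerSeries (Fin 2) k →+* A)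
    (hq : ∀ c : k, π (algebraMap k B c) = q (C c)) (hqX : ∀ i, q (X i) ∈ I) :
    ∃ l : MvPowerSeries (Fin 2) k →ₐ[k] B, ∀ g, π (l g) = q g := by
  choose a ha using fun i => hπ (q (X i))
  have haJ : ∀ i, a i ∈ I.comap π := fun i => by
    rw [Ideal.mem_comap, ha]; exact hqX i
  obtain ⟨l, hl⟩ := exists_algHom_of_isAdicComplete (k := k) (I.comap π) a haJ
  have hlC : ∀ c : k, l (algebraMap k _ c) = algebraMap k B c := fun c => by
    have := hl (MvPolynomial.C c)
    rwa [MvPolynomial.coe_C, MvPolynomial.aeval_C] at this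
  have hlX : ∀ i, l (X i) = a i := fun i => by
    have := hl (MvPolynomial.X i)
    rwa [MvPolynomial.coe_X, MvPolynomial.aeval_X] at this
  have hpoly : ∀ p : MvPolynomial (Fin 2) k, π (l p) = q p := by
    have : ((π.comp l).comp MvPolynomial.coeToMvPowerSeries.ringHom) =
        q.comp MvPolynomial.coeToMvPowerSeries.ringHom := by
      refine MvPolynomial.ringHom_ext (fun c => ?_) fun i => ?_
      · simp only [RingHom.comp_apply, MvPolynomial.coeToMvPowerSeries.ringHom_apply,
          MvPolynomial.coe_C]
        exact (congrArg π (hlC c)).trans (hq c)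
      · simp [hlX, ha]
    exact fun p => RingHom.congr_fun this p
  have hpow : ∀ (r : MvPowerSeries (Fin 2) k →+* A), (∀ i, r (X i) ∈ I) → ∀ n,
      ∀ g ∈ (Ideal.span (Set.range (X : Fin 2 → MvPowerSeries (Fin 2) k))) ^ n, r g ∈ I ^ n := by
    intro r hr n g hg
    have h1 := Ideal.mem_map_of_mem r hg
    rw [Ideal.map_pow] at h1
    refine Ideal.pow_right_mono ?_ n h1
    rw [Ideal.map_span, Ideal.span_le]
    rintro _ ⟨_, ⟨i, rfl⟩, rfl⟩
    exact hr i
  refine ⟨⟨l, hlC⟩, fun g => ?_⟩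
  change π (l g) = q g
  rw [← sub_eq_zero]
  refine IsHausdorff.haus ‹IsHausdorff I A› _ fun n => ?_
  rw [SModEq.zero, smul_eq_mul, Ideal.mul_top]
  obtain ⟨p, hp⟩ := exists_polynomial_sub_mem_pow g n
  have h1 := hpow (π.comp l) (fun i => by rw [RingHom.comp_apply, hlX, ha]; exact hqX i) n _ hp
  have h2 := hpow q hqX n _ hp
  have h3 := sub_mem h1 h2
  rwa [RingHom.comp_apply, map_sub, map_sub, map_sub, hpoly, sub_sub_sub_cancel_right] at h3

end PowerSeriesRing

/-! ### Flat cokernels over a local ring with nilpotent maximal ideal -/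

section Flatness

open TopDef

/-- A linear map `w` into a flat module that is injective modulo the maximal ideal is injective and
has a flat cokernel, if the maximal ideal is nilpotent: the cokernel is even free, on lifts of a
basis of the cokernel of the reduction of `w`. -/
theorem injective_and_flat_of_reduction {R : Type u} [CommRing R] [IsLocalRing R]
    (hR : IsNilpotent (IsLocalRing.maximalIdeal R)) {N N' : Type u} [AddCommGroup N] [Module R N]
    [AddCommGroup N'] [Module R N'] [Module.Flat R N'] (w : N →ₗ[R] N')
    (hw : ∀ x, w x ∈ (IsLocalRing.maximalIdeal R • ⊤ : Submodule R N') →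
      x ∈ (IsLocalRing.maximalIdeal R • ⊤ : Submodule R N)) :
    Function.Injective w ∧ Module.Flat R (N' ⧸ LinearMap.range w) := by
  set m := IsLocalRing.maximalIdeal R
  let _ : Field (R ⧸ m) := Ideal.Quotient.field m
  -- `N' ⧸ W` is the cokernel of the reduction of `w`
  let W : Submodule R N' := m • ⊤ ⊔ LinearMap.range w
  have hW : Module.IsTorsionBySet R (N' ⧸ W) m := by
    rintro z ⟨r, hr⟩
    obtain ⟨y, rfl⟩ := W.mkQ_surjective z
    exact (Submodule.Quotient.mk_eq_zero W).2
      (Submodule.mem_sup_left (Submodule.smul_mem_smul hr trivial))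
  let _ : Module (R ⧸ m) (N' ⧸ W) := hW.module
  have : IsScalarTower R (R ⧸ m) (N' ⧸ W) := hW.isScalarTower
  let b := Module.Basis.ofVectorSpace (R ⧸ m) (N' ⧸ W)
  set ι := Module.Basis.ofVectorSpaceIndex (R ⧸ m) (N' ⧸ W)
  choose c hc using fun i => W.mkQ_surjective (b i)
  let t : (ι →₀ R) →ₗ[R] N' := Finsupp.linearCombination R c
  have ht : ∀ z : ι →₀ R, W.mkQ (t z) =
      Finsupp.linearCombination (R ⧸ m) b (z.mapRange (Ideal.Quotient.mk m) (map_zero _)) := by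
    intro z
    induction z using Finsupp.induction_linear with
    | zero => simp
    | add x y hx hy => rw [map_add, map_add, hx, hy, Finsupp.mapRange_add (map_add _), map_add]
    | single i r =>
      simp only [t, Finsupp.linearCombination_single, Finsupp.mapRange_single, map_smul, hc]
      exact (algebraMap_smul (R ⧸ m) r (b i)).symm
  let v : N × (ι →₀ R) →ₗ[R] N' := w.coprod t
  have hmem : ∀ (x : N) (z : ι →₀ R), x ∈ (m • ⊤ : Submodule R N) → (∀ i, z i ∈ m) →
      (x, z) ∈ (m • ⊤ : Submodule R (N × (ι →₀ R))) := by
    intro x z hx hz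
    have h1 : (x, (0 : ι →₀ R)) ∈ (m • ⊤ : Submodule R (N × (ι →₀ R))) := by
      have := Submodule.mem_map_of_mem (f := LinearMap.inl R N (ι →₀ R)) hx
      rw [Submodule.map_smul''] at this
      exact Submodule.smul_mono le_rfl le_top this
    have h2 : ((0 : N), z) ∈ (m • ⊤ : Submodule R (N × (ι →₀ R))) := by
      have h3 : ((0 : N), z) = z.sum fun i r => r • ((0 : N), Finsupp.single i (1 : R)) := by
        conv_lhs => rw [← LinearMap.inr_apply (R := R), ← Finsupp.sum_single z]
        rw [map_finsuppSum]
        simp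
      rw [h3]
      exact Submodule.sum_mem _ fun i _ => Submodule.smul_mem_smul (hz i) trivial
    simpa using add_mem h1 h2
  have hv : Function.Bijective v := by
    refine bijective_of_nilpotent hR v (fun y => ?_) ?_
    · obtain ⟨z, hz⟩ := Finsupp.mapRange_surjective (Ideal.Quotient.mk m) (map_zero _)
        Ideal.Quotient.mk_surjective (b.repr (W.mkQ y))
      have h1 : y - t z ∈ W := by
        refine (Submodule.Quotient.mk_eq_zero W).1 ?_
        change W.mkQ (y - t z) = 0
        rw [map_sub, ht, hz, b.linearCombination_repr, sub_self]
      obtain ⟨p, hp, _, ⟨x, rfl⟩, hpq⟩ := Submodule.mem_sup.1 h1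
      refine ⟨(x, z), ?_⟩
      have : y - v (x, z) = p := by
        rw [LinearMap.coprod_apply, ← sub_sub, sub_right_comm, ← hpq, add_sub_cancel_right]
      rwa [this]
    · rintro ⟨x, z⟩ hxz
      rw [LinearMap.coprod_apply] at hxz
      have h1 : t z ∈ W := by
        have := sub_mem (Submodule.mem_sup_left hxz : _ ∈ W)
          (Submodule.mem_sup_right ⟨x, rfl⟩ : w x ∈ W)
        rwa [add_sub_cancel_left] at this
      have h2 := ht z
      rw [show W.mkQ (t z) = 0 from (Submodule.Quotient.mk_eq_zero W).2 h1] at h2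
      have h3 := linearIndependent_iff.1 b.linearIndependent _ h2.symm
      have hz : ∀ i, z i ∈ m := fun i =>
        Ideal.Quotient.eq_zero_iff_mem.1 (by simpa using DFunLike.congr_fun h3 i)
      refine hmem x z (hw x ?_) hz
      have htz : t z ∈ (m • ⊤ : Submodule R N') := by
        rw [Finsupp.linearCombination_apply]
        exact Submodule.sum_mem _ fun i _ => Submodule.smul_mem_smul (hz i) trivial
      simpa using sub_mem hxz htz
  constructor
  · intro x x' h
    have : v (x, 0) = v (x', 0) := by simpa [v] using h
    exact congrArg Prod.fst (hv.1 this)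
  · let q : (ι →₀ R) →ₗ[R] N' ⧸ LinearMap.range w := (LinearMap.range w).mkQ.comp t
    refine Module.Flat.of_linearEquiv (LinearEquiv.ofBijective q ⟨?_, fun y => ?_⟩).symm
    · rw [injective_iff_map_eq_zero]
      intro z hz
      obtain ⟨x, hx⟩ := (Submodule.Quotient.mk_eq_zero _).1 hz
      have h : v (-x, z) = v 0 := by simp [v, hx]
      exact congrArg Prod.snd (hv.1 h)
    · obtain ⟨y, rfl⟩ := Submodule.mkQ_surjective _ y
      obtain ⟨⟨x, z⟩, rfl⟩ := hv.2 y
      refine ⟨z, (Submodule.Quotient.eq _).2 ⟨-x, ?_⟩⟩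
      simp [v]

end Flatness

/-! ### Semilinear maps given by a family of vectors -/

section CoordMap

variable {P B N : Type*} [CommRing P] [CommRing B] [AddCommGroup N] [Module B N] {n : ℕ}

/-- The `σ`-semilinear map `P ^ n → N`, `v ↦ ∑ i, σ (v i) • E i`, sending the standard basis to
the family `E`. -/
def coordMap (σ : P →+* B) (E : Fin n → N) : (Fin n → P) →ₛₗ[σ] N where
  toFun v := ∑ i, σ (v i) • E i
  map_add' v w := by simp [add_smul, Finset.sum_add_distrib]
  map_smul' a v := by simp [mul_smul, Finset.smul_sum]

theorem coordMap_apply (σ : P →+* B) (E : Fin n → N) (v : Fin n → P) :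
    coordMap σ E v = ∑ i, σ (v i) • E i := rfl

theorem coordMap_mulVec (σ : P →+* B) (E : Fin n → N) (Ψ : Matrix (Fin n) (Fin n) P)
    (c : Fin n → P) :
    coordMap σ E (Ψ.mulVec c) = coordMap σ (fun j => coordMap σ E (Ψ.col j)) c := by
  simp only [coordMap_apply, Matrix.mulVec, dotProduct, map_sum, map_mul, Finset.sum_smul,
    Finset.smul_sum, smul_smul, Matrix.col_apply]
  rw [Finset.sum_comm]
  simp only [mul_comm]

theorem coordMap_mulVec_eq_zero {σ : P →+* B} {E : Fin n → N} {Ψ : Matrix (Fin n) (Fin n) P}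
    (h : ∀ j, coordMap σ E (Ψ.col j) = 0) (c : Fin n → P) : coordMap σ E (Ψ.mulVec c) = 0 := by
  rw [coordMap_mulVec]
  simp [coordMap_apply, h]

/-- Cramer's rule: if the columns of `Ψ` are relations between the `E i`, then `det Ψ` kills every
linear combination of the `E i`. -/
theorem det_smul_coordMap {σ : P →+* B} {E : Fin n → N} {Ψ : Matrix (Fin n) (Fin n) P}
    (h : ∀ j, coordMap σ E (Ψ.col j) = 0) (v : Fin n → P) : σ Ψ.det • coordMap σ E v = 0 := by
  rw [← map_smulₛₗ, ← coordMap_mulVec_eq_zero h (Ψ.adjugate.mulVec v), Matrix.mulVec_mulVec,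
    Matrix.mul_adjugate, Matrix.smul_mulVec, Matrix.one_mulVec]

end CoordMap

/-! ### Coordinatewise reduction and nilpotent ideals -/

theorem mem_smul_top_pi {R P : Type*} [CommRing R] [AddCommGroup P] [Module R P] {n : ℕ}
    (I : Ideal R) (v : Fin n → P) :
    v ∈ (I • ⊤ : Submodule R (Fin n → P)) ↔ ∀ i, v i ∈ (I • ⊤ : Submodule R P) := by
  constructor
  · intro h i
    have := Submodule.mem_map_of_mem (f := LinearMap.proj (R := R) (φ := fun _ : Fin n => P) i) h
    rw [Submodule.map_smul''] at this
    exact Submodule.smul_mono le_rfl le_top this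
  · intro h
    have hv : v = ∑ i, LinearMap.single R (fun _ : Fin n => P) i (v i) :=
      (Finset.univ_sum_single v).symm
    rw [hv]
    refine Submodule.sum_mem _ fun i _ => ?_
    have := Submodule.mem_map_of_mem (f := LinearMap.single R (fun _ : Fin n => P) i) (h i)
    rw [Submodule.map_smul''] at this
    exact Submodule.smul_mono le_rfl le_top this

/-- Nakayama's lemma for a nilpotent ideal: a linear map that is surjective modulo the ideal is
surjective. -/
theorem range_eq_top_of_isNilpotent {R N N' : Type*} [CommRing R] [AddCommGroup N] [Module R N]
    [AddCommGroup N'] [Module R N'] {J : Ideal R} (hJ : IsNilpotent J) (w : N →ₗ[R] N')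
    (hw : ∀ y, ∃ x, y - w x ∈ (J • ⊤ : Submodule R N')) : LinearMap.range w = ⊤ := by
  have h1 : (⊤ : Submodule R N') ≤ LinearMap.range w ⊔ J • ⊤ := fun y _ => by
    obtain ⟨x, hx⟩ := hw y
    exact Submodule.mem_sup.2 ⟨w x, ⟨x, rfl⟩, _, hx, by abel⟩
  have h : ∀ i : ℕ, (⊤ : Submodule R N') ≤ LinearMap.range w ⊔ J ^ i • ⊤ := by
    intro i
    induction i with
    | zero => simp
    | succ i ih =>
      calc (⊤ : Submodule R N') ≤ _ := ih
        _ ≤ LinearMap.range w ⊔ J ^ i • (LinearMap.range w ⊔ J • ⊤) :=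
          sup_le_sup_left (smul_mono_right _ h1) _
        _ ≤ _ := by
          rw [Submodule.smul_sup, ← Submodule.mul_smul, ← pow_succ, ← sup_assoc]
          exact sup_le_sup_right (sup_le le_rfl Submodule.smul_le_right) _
  obtain ⟨m, hm⟩ := hJ
  have := h m
  rw [hm] at this
  simpa using this

/-! ### Extension of scalars of a `k`-algebra to an object of `Art_k` -/

section Augmentation

variable {k : Type u} [Field k] (R : ArtAlg k) (O : Type u) [CommRing O] [Algebra k O]

/-- The reduction `R ⊗[k] O → O` modulo the maximal ideal of `R`. -/
noncomputable def augmentation : R ⊗[k] O →ₐ[k] O :=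
  Algebra.TensorProduct.lift ((Algebra.ofId k O).comp R.toBase) (AlgHom.id k O)
    fun _ _ => Commute.all _ _

variable {R O}

theorem augmentation_tmul (r : R) (g : O) :
    augmentation R O (r ⊗ₜ g) = algebraMap k O (R.toBase r) * g := rfl

theorem augmentation_one_tmul (g : O) : augmentation R O (1 ⊗ₜ g) = g := by
  rw [augmentation_tmul, map_one, map_one, one_mul]

theorem toBase_eq_zero_iff (r : R) : R.toBase r = 0 ↔ r ∈ R.max := by
  rw [← R.ker_toBase]; rfl

theorem augmentation_smul (r : R) (z : R ⊗[k] O) :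
    augmentation R O (r • z) = algebraMap k O (R.toBase r) * augmentation R O z := by
  rw [Algebra.smul_def, map_mul, Algebra.TensorProduct.algebraMap_apply, augmentation_tmul]
  simp

theorem augmentation_eq_zero_iff (z : R ⊗[k] O) :
    augmentation R O z = 0 ↔ z ∈ (R.max • ⊤ : Submodule R (R ⊗[k] O)) := by
  have h1 : ∀ z ∈ (R.max • ⊤ : Submodule R (R ⊗[k] O)), augmentation R O z = 0 := fun z hz => by
    refine Submodule.smul_induction_on hz (fun r hr y _ => ?_) fun a b ha hb => ?_
    · rw [augmentation_smul, (toBase_eq_zero_iff r).2 hr, map_zero, zero_mul]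
    · rw [map_add, ha, hb, add_zero]
  have h2 : ∀ z : R ⊗[k] O, ∃ g : O, z - 1 ⊗ₜ g ∈ (R.max • ⊤ : Submodule R (R ⊗[k] O)) := by
    intro z
    induction z with
    | zero => exact ⟨0, by simp⟩
    | add x y hx hy =>
      obtain ⟨a, ha⟩ := hx
      obtain ⟨b, hb⟩ := hy
      refine ⟨a + b, ?_⟩
      rw [tmul_add, add_sub_add_comm]
      exact add_mem ha hb
    | tmul r g =>
      obtain ⟨c, hc⟩ := R.exists_scalar r
      refine ⟨c • g, ?_⟩
      have : r ⊗ₜ[k] g - 1 ⊗ₜ[k] (c • g) = (r - algebraMap k R c) • ((1 : R) ⊗ₜ[k] g) := by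
        rw [← TensorProduct.smul_tmul, ← TensorProduct.sub_tmul, TensorProduct.smul_tmul',
          smul_eq_mul, mul_one, Algebra.algebraMap_eq_smul_one]
      rw [this]
      exact Submodule.smul_mem_smul hc trivial
  refine ⟨fun hz => ?_, h1 z⟩
  obtain ⟨g, hg⟩ := h2 z
  have h3 := h1 _ hg
  rw [map_sub, hz, augmentation_one_tmul, zero_sub, neg_eq_zero] at h3
  rwa [h3, tmul_zero, sub_zero] at hg

/-- The map `R ⊗[k] O → S ⊗[k] O` induced by a morphism `R ⟶ S` of `Art_k`. -/
noncomputable def extMap {R S : ArtAlg k} (φ : R ⟶ S) (O : Type u) [CommRing O] [Algebra k O] :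
    R ⊗[k] O →ₐ[k] S ⊗[k] O :=
  Algebra.TensorProduct.map (ArtAlg.toAlgHom φ) (AlgHom.id k O)

theorem extMap_tmul {R S : ArtAlg k} (φ : R ⟶ S) (r : R) (g : O) :
    extMap φ O (r ⊗ₜ g) = ArtAlg.toAlgHom φ r ⊗ₜ g := rfl

theorem extMap_surjective {R S : ArtAlg k} (φ : R ⟶ S)
    (hφ : Function.Surjective (ArtAlg.toAlgHom φ)) : Function.Surjective (extMap φ O) :=
  TensorProduct.map_surjective hφ Function.surjective_id

theorem augmentation_extMap {R S : ArtAlg k} (φ : R ⟶ S) (z : R ⊗[k] O) :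
    augmentation S O (extMap φ O z) = augmentation R O z := by
  induction z with
  | zero => simp
  | add x y hx hy => simp only [map_add, hx, hy]
  | tmul r g => rw [extMap_tmul, augmentation_tmul, augmentation_tmul, ArtAlg.toBase_toAlgHom]

end Augmentation

/-! ### Square presentations of torsion-free modules of rank one -/

section Presentation

/-- A square presentation of a module `M` over a quotient `A` of a ring `O` along `q : O →+* A`:
the cokernel of an injective square matrix over `O` whose determinant generates the kernel
of `q`. -/
structure SquarePresentation {O A : Type*} [CommRing O] [CommRing A] (q : O →+* A) (M : Type*)
    [AddCommGroup M] [Module A M] where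
  /-- the number of generators, which is also the number of relations -/
  size : ℕ
  gen : Fin size → M
  matrix : Matrix (Fin size) (Fin size) O
  span_gen : Submodule.span A (Set.range gen) = ⊤
  mulVec_eq_zero : ∀ c, matrix.mulVec c = 0 → c = 0
  coordMap_eq_zero_iff : ∀ v, coordMap q gen v = 0 ↔ ∃ c, matrix.mulVec c = v
  det_ne_zero : matrix.det ≠ 0
  ker_eq : RingHom.ker q = Ideal.span {matrix.det}

theorem exists_squarePresentation {O : Type*} [CommRing O] [IsDomain O] [IsNoetherianRing O]
    [IsLocalRing O] {x y : O} (hx : Prime x)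
    (hmax : IsLocalRing.maximalIdeal O = Ideal.span {x, y}) {A : Type*} [CommRing A] {q : O →+* A}
    (hq : Function.Surjective q) {f : O} (hf : f ≠ 0) (hker : RingHom.ker q = Ideal.span {f})
    {M : Type*} [AddCommGroup M] [Module A M] [Module.Finite A M] (ι : M →ₗ[A] A)
    (hι : Function.Injective ι) (m : M) (hm : ι m ∈ nonZeroDivisors A) :
    Nonempty (SquarePresentation q M) := by
  have hq0 : ∀ a, q a = 0 ↔ f ∣ a := fun a => by
    rw [← RingHom.mem_ker, hker, Ideal.mem_span_singleton]
  obtain ⟨n, e, he⟩ := Module.Finite.exists_fin (R := A) (M := M)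
  choose g hg using fun i => hq (ι (e i))
  have hsum : ∀ v : Fin n → O, ι (coordMap q e v) = q (∑ i, v i * g i) := fun v => by
    simp [coordMap_apply, hg]
  have hdvd : ∀ v : Fin n → O, coordMap q e v = 0 ↔ f ∣ ∑ i, v i * g i := fun v => by
    rw [← map_eq_zero_iff ι hι, hsum, hq0]
  obtain ⟨Φ, hΦ0, hΦ⟩ := exists_square_presentation hx hmax g hf
  obtain ⟨c, hc⟩ := (Submodule.mem_span_range_iff_exists_fun A).1
    (he ▸ Submodule.mem_top : m ∈ Submodule.span A (Set.range e))
  choose w hw using fun i => hq (c i)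
  have hwm : coordMap q e w = m := by
    rw [coordMap_apply, ← hc]
    simp only [hw]
  have hspan := span_det_eq hf hΦ (w := w) fun a ha => by
    rw [← hq0, map_mul, ← hsum, hwm] at ha
    exact (hq0 _).1 ((mul_left_mem_nonZeroDivisors_eq_zero_iff hm).1 ha)
  refine ⟨⟨n, e, Φ, he, hΦ0, fun v => by rw [hdvd, hΦ], fun h => hf ?_, hker.trans hspan.symm⟩⟩
  rwa [h, Ideal.span_singleton_eq_bot.2 rfl, eq_comm, Ideal.span_singleton_eq_bot] at hspan

end Presentation

/-! ### The cokernel of a matrix as a module modulo the determinant -/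

section Cokernel

/-- Cramer's rule: the determinant kills the cokernel. -/
theorem isTorsionBySet_coker {P : Type*} [CommRing P] {n : ℕ} (Ψ : Matrix (Fin n) (Fin n) P) :
    Module.IsTorsionBySet P ((Fin n → P) ⧸ LinearMap.range Ψ.mulVecLin)
      (Ideal.span {Ψ.det} : Ideal P) := by
  refine (Module.isTorsionBySet_span_singleton_iff Ψ.det).2 ?_
  intro z
  obtain ⟨v, rfl⟩ := Submodule.mkQ_surjective _ z
  rw [← map_smul]
  refine (Submodule.Quotient.mk_eq_zero _).2 ⟨Ψ.adjugate.mulVec v, ?_⟩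
  rw [Matrix.mulVecLin_apply, Matrix.mulVec_mulVec, Matrix.mul_adjugate, Matrix.smul_mulVec,
    Matrix.one_mulVec]

/-- The cokernel of a square matrix as a module over the quotient by the determinant. -/
noncomputable instance cokerModule {P : Type*} [CommRing P] {n : ℕ}
    (Ψ : Matrix (Fin n) (Fin n) P) :
    Module (P ⧸ Ideal.span {Ψ.det}) ((Fin n → P) ⧸ LinearMap.range Ψ.mulVecLin) :=
  (isTorsionBySet_coker Ψ).module

theorem mk_smul_coker {P : Type*} [CommRing P] {n : ℕ} (Ψ : Matrix (Fin n) (Fin n) P) (z : P)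
    (y : (Fin n → P) ⧸ LinearMap.range Ψ.mulVecLin) :
    Ideal.Quotient.mk (Ideal.span {Ψ.det}) z • y = z • y := rfl

instance coker_isScalarTower {R P : Type*} [CommRing R] [CommRing P] [Algebra R P] {n : ℕ}
    (Ψ : Matrix (Fin n) (Fin n) P) :
    IsScalarTower R (P ⧸ Ideal.span {Ψ.det}) ((Fin n → P) ⧸ LinearMap.range Ψ.mulVecLin) :=
  (isTorsionBySet_coker Ψ).isScalarTower

end Cokernel

/-! ### Deformations given by matrices -/

section Deformations

variable {k : Type u} [Field k] {A : Type u} [CommRing A] [Algebra k A] {I : Ideal A}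
  {M : Type u} [AddCommGroup M] [Module A M] {R S : ArtAlg k}

/-- The topological deformation given by a flat deformation of the algebra and the module: the
completeness conditions are automatic. -/
@[reducible] noncomputable def TopDef.ofFlat [IsNoetherianRing A] [IsAdicComplete I A]
    [Module.Finite A M] {B N : Type u} [CommRing B] [Algebra R B]
    [Module.Flat R B] [AddCommGroup N] [Module R N] [Module B N] [IsScalarTower R B N]
    [Module.Flat R N] (red : B →+* A)
    (red_algebraMap : ∀ r : R, red (algebraMap R B r) = algebraMap k A (R.toBase r))
    (red_surjective : Function.Surjective red)
    (ker_red : RingHom.ker red = R.max.map (algebraMap R B)) (redMod : N →+ M)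
    (redMod_smul : ∀ (b : B) (n : N), redMod (b • n) = red b • redMod n)
    (redMod_surjective : Function.Surjective redMod)
    (redMod_eq_zero_iff : ∀ n : N, redMod n = 0 ↔ n ∈ (R.max • ⊤ : Submodule R N)) :
    TopDef I M R where
  alg := B
  red := red
  red_algebraMap c := by rw [red_algebraMap, AlgHom.commutes]; rfl
  red_surjective := red_surjective
  ker_red := ker_red
  complete := TopDef.complete_of_flat red red_surjective ker_red red.toAddMonoidHom
    (fun b n => map_mul red b n) red_surjective (fun n hn => by
      rw [Ideal.smul_top_eq_map, ← ker_red]; exact hn)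
  mod := N
  redMod := redMod
  redMod_smul := redMod_smul
  redMod_surjective := redMod_surjective
  redMod_eq_zero_iff := redMod_eq_zero_iff
  completeMod := TopDef.complete_of_flat red red_surjective ker_red redMod
    redMod_smul redMod_surjective (fun n hn => (redMod_eq_zero_iff n).1 hn)


/-- Given a `k`-algebra `A` presented as a quotient `q : O →+* A`, a flat `R`-algebra `P` with an
isomorphism of `k ⊗_R P` with `O`, given as a surjection `aug : P → O` with kernel `m_R P`, that is
compatible with the structure of `k`-algebra of `A`. -/
structure FlatCover (R : ArtAlg k) {O : Type u} [CommRing O] (q : O →+* A) where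
  P : Type u
  [commRing : CommRing P]
  [algebra : Algebra R P]
  [flat : Module.Flat R P]
  aug : P →+* O
  aug_surjective : Function.Surjective aug
  aug_eq_zero_iff : ∀ z, aug z = 0 ↔ z ∈ (R.max • ⊤ : Submodule R P)
  aug_algebraMap : ∀ r, q (aug (algebraMap R P r)) = algebraMap k A (R.toBase r)

attribute [instance] FlatCover.commRing FlatCover.algebra FlatCover.flat

namespace SquarePresentation

variable {O : Type u} [CommRing O] {q : O →+* A} (Q : SquarePresentation q M) (T : FlatCover R q)

theorem coordMap_comp_aug (v : Fin Q.size → T.P) :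
    coordMap (q.comp T.aug) Q.gen v = coordMap q Q.gen fun i => T.aug (v i) := rfl

theorem coordMap_surjective (hq : Function.Surjective q) :
    Function.Surjective (coordMap (q.comp T.aug) Q.gen) := by
  intro m
  obtain ⟨c, hc⟩ := (Submodule.mem_span_range_iff_exists_fun A).1
    (Q.span_gen ▸ Submodule.mem_top : m ∈ Submodule.span A (Set.range Q.gen))
  choose w hw using fun i => (hq.comp T.aug_surjective) (c i)
  refine ⟨w, ?_⟩
  rw [coordMap_apply, ← hc]
  exact Finset.sum_congr rfl fun i _ => congrArg (· • Q.gen i) (hw i)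

variable {Q T} {Ψ : Matrix (Fin Q.size) (Fin Q.size) T.P}

theorem aug_det (hΨ : Ψ.map T.aug = Q.matrix) : T.aug Ψ.det = Q.matrix.det := by
  rw [RingHom.map_det, ← hΨ]; rfl

theorem aug_mulVec (hΨ : Ψ.map T.aug = Q.matrix) (c : Fin Q.size → T.P) :
    (fun i => T.aug (Ψ.mulVec c i)) = Q.matrix.mulVec fun i => T.aug (c i) := by
  ext1 i
  rw [← hΨ]
  simp [Matrix.mulVec, dotProduct, map_sum]

theorem comp_aug_det (hΨ : Ψ.map T.aug = Q.matrix) : q.comp T.aug Ψ.det = 0 := by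
  rw [RingHom.comp_apply, aug_det hΨ, ← RingHom.mem_ker, Q.ker_eq]
  exact Ideal.mem_span_singleton_self _

theorem coordMap_comp_aug_mulVec (hΨ : Ψ.map T.aug = Q.matrix) (c : Fin Q.size → T.P) :
    coordMap (q.comp T.aug) Q.gen (Ψ.mulVec c) = 0 := by
  rw [coordMap_comp_aug, aug_mulVec hΨ]
  exact (Q.coordMap_eq_zero_iff _).2 ⟨_, rfl⟩

theorem flat_quotient_det [IsDomain O] (hΨ : Ψ.map T.aug = Q.matrix) :
    Module.Flat R (T.P ⧸ Ideal.span {Ψ.det}) := by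
  let w : T.P →ₗ[R] T.P := LinearMap.mulLeft R Ψ.det
  have hw := (injective_and_flat_of_reduction R.isNilpotent_max w fun x hx => by
    rw [← T.aug_eq_zero_iff] at hx ⊢
    rw [LinearMap.mulLeft_apply, map_mul, aug_det hΨ] at hx
    exact (mul_eq_zero.1 hx).resolve_left Q.det_ne_zero).2
  have hrange : LinearMap.range w = (Ideal.span {Ψ.det}).restrictScalars R := by
    ext z
    rw [Submodule.restrictScalars_mem, Ideal.mem_span_singleton]
    exact ⟨fun ⟨a, ha⟩ => ⟨a, ha.symm⟩, fun ⟨a, ha⟩ => ⟨a, ha.symm⟩⟩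
  rw [hrange] at hw
  exact Module.Flat.of_linearEquiv (Submodule.Quotient.restrictScalarsEquiv R _).symm

theorem flat_coker (hΨ : Ψ.map T.aug = Q.matrix) :
    Module.Flat R ((Fin Q.size → T.P) ⧸ LinearMap.range Ψ.mulVecLin) := by
  let w : (Fin Q.size → T.P) →ₗ[R] (Fin Q.size → T.P) := Ψ.mulVecLin.restrictScalars R
  have : Module.Flat R (Fin Q.size → T.P) :=
    Module.Flat.of_linearEquiv (DFinsupp.linearEquivFunOnFintype (R := R)
      (M := fun _ : Fin Q.size => T.P)).symm
  have hw := (injective_and_flat_of_reduction R.isNilpotent_max w fun x hx => by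
    rw [mem_smul_top_pi] at hx ⊢
    simp only [← T.aug_eq_zero_iff] at hx ⊢
    exact fun i => congrFun (Q.mulVec_eq_zero _ ((aug_mulVec hΨ x).symm.trans (funext hx))) i).2
  have hrange : LinearMap.range w = (LinearMap.range Ψ.mulVecLin).restrictScalars R := rfl
  rw [hrange] at hw
  exact Module.Flat.of_linearEquiv (Submodule.Quotient.restrictScalarsEquiv R _).symm

end SquarePresentation

open SquarePresentation

variable {O : Type u} [CommRing O] {q : O →+* A}

/-- The deformation given by a matrix `Ψ` that lifts the matrix of a square presentation of `M`:
the algebra is the quotient by `det Ψ` and the module is the cokernel of `Ψ`. -/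
@[reducible] noncomputable def TopDef.ofMatrix [IsDomain O] [IsNoetherianRing A]
    [IsAdicComplete I A] [Module.Finite A M] (hq : Function.Surjective q)
    (Q : SquarePresentation q M) (T : FlatCover R q)
    (Ψ : Matrix (Fin Q.size) (Fin Q.size) T.P) (hΨ : Ψ.map T.aug = Q.matrix) :
    TopDef I M R :=
  haveI : Module.Flat R (T.P ⧸ Ideal.span {Ψ.det}) := flat_quotient_det hΨ
  haveI : Module.Flat R ((Fin Q.size → T.P) ⧸ LinearMap.range Ψ.mulVecLin) := flat_coker hΨ
  let red : (T.P ⧸ Ideal.span {Ψ.det}) →+* A :=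
    Ideal.Quotient.lift _ (q.comp T.aug) fun a ha => by
      obtain ⟨b, rfl⟩ := Ideal.mem_span_singleton.1 ha
      rw [map_mul, comp_aug_det hΨ, zero_mul]
  let redMod : ((Fin Q.size → T.P) ⧸ LinearMap.range Ψ.mulVecLin) →ₛₗ[q.comp T.aug] M :=
    Submodule.liftQ _ (coordMap (q.comp T.aug) Q.gen) <| by
      rintro _ ⟨c, rfl⟩
      exact coordMap_comp_aug_mulVec hΨ c
  have red_algebraMap : ∀ r : R, red (algebraMap R (T.P ⧸ Ideal.span {Ψ.det}) r) =
      algebraMap k A (R.toBase r) := T.aug_algebraMap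
  have redMod_smul : ∀ (b : T.P ⧸ Ideal.span {Ψ.det})
      (n : (Fin Q.size → T.P) ⧸ LinearMap.range Ψ.mulVecLin),
      redMod (b • n) = red b • redMod n := fun b n => by
    obtain ⟨z, rfl⟩ := Ideal.Quotient.mk_surjective b
    rw [mk_smul_coker]
    exact map_smulₛₗ redMod z n
  TopDef.ofFlat red red_algebraMap
    (Ideal.Quotient.lift_surjective_of_surjective _ _ (hq.comp T.aug_surjective))
    (by
      refine le_antisymm (fun b hb => ?_) (Ideal.map_le_iff_le_comap.2 fun r hr => ?_)
      · obtain ⟨z, rfl⟩ := Ideal.Quotient.mk_surjective b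
        have h1 : T.aug z ∈ RingHom.ker q := hb
        rw [Q.ker_eq, Ideal.mem_span_singleton] at h1
        obtain ⟨g, hg⟩ := h1
        obtain ⟨g, rfl⟩ := T.aug_surjective g
        have h2 : T.aug (z - Ψ.det * g) = 0 := by
          rw [map_sub, map_mul, aug_det hΨ, hg, sub_self]
        rw [T.aug_eq_zero_iff, Ideal.smul_top_eq_map, Submodule.restrictScalars_mem] at h2
        have h3 := Ideal.mem_map_of_mem (Ideal.Quotient.mk (Ideal.span {Ψ.det})) h2
        rw [map_sub, map_mul,
          Ideal.Quotient.eq_zero_iff_mem.2 (Ideal.mem_span_singleton_self Ψ.det),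
          zero_mul, sub_zero, Ideal.map_map] at h3
        exact h3
      · rw [Ideal.mem_comap, RingHom.mem_ker, red_algebraMap, (toBase_eq_zero_iff r).2 hr,
          map_zero])
    redMod.toAddMonoidHom redMod_smul
    (fun m => by
      obtain ⟨v, hv⟩ := Q.coordMap_surjective T hq m
      exact ⟨Submodule.Quotient.mk v, hv⟩)
    (fun n => by
      constructor
      · obtain ⟨v, rfl⟩ := Submodule.mkQ_surjective _ n
        intro h1
        obtain ⟨c, hc⟩ := (Q.coordMap_eq_zero_iff _).1 ((Q.coordMap_comp_aug T v).symm.trans h1)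
        choose c' hc' using fun i => T.aug_surjective (c i)
        have h2 : v - Ψ.mulVec c' ∈ (R.max • ⊤ : Submodule R (Fin Q.size → T.P)) := by
          rw [mem_smul_top_pi]
          intro i
          rw [← T.aug_eq_zero_iff, Pi.sub_apply, map_sub, ← congrFun hc i,
            congrFun (aug_mulVec hΨ _) i]
          simp only [hc', sub_self]
        have h3 := Submodule.mem_map_of_mem
          (f := (LinearMap.range Ψ.mulVecLin).mkQ.restrictScalars R) h2
        rw [Submodule.map_smul'', LinearMap.restrictScalars_apply, map_sub] at h3
        have h4 : (LinearMap.range Ψ.mulVecLin).mkQ (Ψ.mulVec c') = 0 :=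
          (Submodule.Quotient.mk_eq_zero _).2 ⟨_, rfl⟩
        rw [h4, sub_zero] at h3
        exact Submodule.smul_mono le_rfl le_top h3
      · intro hn
        refine Submodule.smul_induction_on hn (fun r hr x _ => ?_) fun a b ha hb => ?_
        · rw [← algebraMap_smul (T.P ⧸ Ideal.span {Ψ.det}) r x]
          refine (redMod_smul _ x).trans ?_
          rw [red_algebraMap, (toBase_eq_zero_iff r).2 hr, map_zero, zero_smul]
        · rw [map_add, ha, hb, add_zero])

/-- If a homomorphism `τ` to the algebra of a deformation `D` kills `det Ψ`, and the columns of
`Ψ` give relations between lifts `E` of the generators of `M`, then the deformation given by `Ψ`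
maps to `D`. -/
theorem TopDef.ofMatrix_nonempty_homOver [IsDomain O] [IsNoetherianRing A]
    [IsAdicComplete I A] [Module.Finite A M] (hq : Function.Surjective q)
    (Q : SquarePresentation q M) (T : FlatCover R q)
    (Ψ : Matrix (Fin Q.size) (Fin Q.size) T.P) (hΨ : Ψ.map T.aug = Q.matrix)
    (φ : R ⟶ S) (D : TopDef I M S) (τ : T.P →+* D.alg)
    (hτR : ∀ r, τ (algebraMap R T.P r) = algebraMap S D.alg (ArtAlg.toAlgHom φ r))
    (hτ : ∀ z, D.red (τ z) = q (T.aug z))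
    (E : Fin Q.size → D.mod) (hE : ∀ i, D.redMod (E i) = Q.gen i)
    (hdet : τ Ψ.det = 0) (hcol : ∀ j, coordMap τ E (Ψ.col j) = 0) :
    Nonempty (TopDef.HomOver φ (TopDef.ofMatrix hq Q T Ψ hΨ) D) := by
  let h : (T.P ⧸ Ideal.span {Ψ.det}) →+* D.alg := Ideal.Quotient.lift _ τ fun a ha => by
    obtain ⟨b, rfl⟩ := Ideal.mem_span_singleton.1 ha
    rw [map_mul, hdet, zero_mul]
  let hM : ((Fin Q.size → T.P) ⧸ LinearMap.range Ψ.mulVecLin) →ₛₗ[τ] D.mod :=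
    Submodule.liftQ _ (coordMap τ E) <| by
      rintro _ ⟨c, rfl⟩
      exact coordMap_mulVec_eq_zero hcol c
  refine ⟨⟨h, hτR, fun b => ?_, hM.toAddMonoidHom, fun b n => ?_, fun n => ?_⟩⟩
  · obtain ⟨z, rfl⟩ := Ideal.Quotient.mk_surjective b
    exact hτ z
  · obtain ⟨z, rfl⟩ := Ideal.Quotient.mk_surjective b
    exact map_smulₛₗ hM z n
  · obtain ⟨v, rfl⟩ := Submodule.mkQ_surjective _ n
    change D.redMod (∑ i, τ (v i) • E i) = ∑ i, q (T.aug (v i)) • Q.gen i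
    simp only [map_sum, D.redMod_smul, hτ, hE]

/-- Every deformation of the pair comes from a lift `Ψ` of the presentation matrix. The columns of
`Ψ` exist because the relations between the generators lift. The determinant of `Ψ` vanishes in the
deformed algebra because it kills the deformed module, into which the algebra embeds by acting
on a lift of `m`. -/
theorem TopDef.exists_matrix (hq : Function.Surjective q) (Q : SquarePresentation q M) {m : M}
    (hm : ∀ a : A, a • m = 0 → a = 0) (T : FlatCover R q) (D : TopDef I M R)
    (π : T.P →ₐ[R] D.alg) (hπ : ∀ z, D.red (π z) = q (T.aug z))
    (E : Fin Q.size → D.mod) (hE : ∀ i, D.redMod (E i) = Q.gen i) :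
    ∃ Ψ : Matrix (Fin Q.size) (Fin Q.size) T.P, Ψ.map T.aug = Q.matrix ∧ π Ψ.det = 0 ∧
      ∀ j, coordMap (π : T.P →+* D.alg) E (Ψ.col j) = 0 := by
  let σ : T.P →+* D.alg := π
  let p : (Fin Q.size → T.P) →ₗ[R] D.mod :=
    { toFun := coordMap σ E
      map_add' := map_add _
      map_smul' := fun r v => by simp [coordMap_apply, σ, Finset.smul_sum] }
  have hp : ∀ v, p v = coordMap σ E v := fun _ => rfl
  have hred : ∀ v, D.redMod (p v) = coordMap (q.comp T.aug) Q.gen v := fun v => by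
    rw [hp, coordMap_apply, coordMap_apply, map_sum]
    simp only [D.redMod_smul, hE]
    exact Finset.sum_congr rfl fun i _ => congrArg (· • Q.gen i) (hπ (v i))
  have htop : LinearMap.range p = ⊤ := by
    refine range_eq_top_of_isNilpotent R.isNilpotent_max p fun y => ?_
    obtain ⟨v, hv⟩ := Q.coordMap_surjective T hq (D.redMod y)
    exact ⟨v, (D.redMod_eq_zero_iff _).1 (by rw [map_sub, hred, hv, sub_self])⟩
  have hcol : ∀ j, ∃ v, (∀ i, T.aug (v i) = Q.matrix i j) ∧ p v = 0 := fun j => by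
    choose u hu using fun i => T.aug_surjective (Q.matrix i j)
    have h1 : D.redMod (p u) = 0 := by
      rw [hred, Q.coordMap_comp_aug]
      simp only [hu]
      exact (Q.coordMap_eq_zero_iff _).2 ⟨Pi.single j 1, Matrix.mulVec_single_one _ _⟩
    -- correct an arbitrary lift of the column by an element of the kernel of the reduction
    rw [D.redMod_eq_zero_iff, ← htop, ← Submodule.map_top, ← Submodule.map_smul''] at h1
    obtain ⟨v, hv, hv'⟩ := h1
    refine ⟨u - v, fun i => ?_, by rw [map_sub, hv', sub_self]⟩
    rw [Pi.sub_apply, map_sub, hu, (T.aug_eq_zero_iff (v i)).2 ((mem_smul_top_pi _ v).1 hv i),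
      sub_zero]
  choose V hV hV' using hcol
  refine ⟨(Matrix.of V).transpose, ?_, ?_, hV'⟩
  · ext1 i j
    exact hV j i
  · obtain ⟨y, hy⟩ := D.redMod_surjective m
    let w : D.alg →ₗ[R] D.mod := (LinearMap.toSpanSingleton D.alg D.mod y).restrictScalars R
    have hw := (injective_and_flat_of_reduction R.isNilpotent_max w fun a ha => by
      rw [← D.redMod_eq_zero_iff] at ha
      have h1 : D.red a • m = 0 := by rw [← hy, ← D.redMod_smul]; exact ha
      rw [Ideal.smul_top_eq_map, Submodule.restrictScalars_mem, ← D.ker_red]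
      exact hm _ h1).1
    refine hw ?_
    rw [map_zero]
    obtain ⟨v, rfl⟩ : y ∈ LinearMap.range p := htop ▸ Submodule.mem_top
    exact det_smul_coordMap (σ := σ) (E := E) hV' v

end Deformations

/-! ### Deformations of plane curves -/

section PlaneCurveDeformations

open MvPowerSeries

variable {k : Type u} [Field k] {f : MvPowerSeries (Fin 2) k}
  {M : Type u} [AddCommGroup M] [Module (PlaneCurve f) M]

/-- The algebra `R ⊗[k] k[[x,y]]`, as the flat lift of `k[[x,y]]` used to present the
deformations of `k[[x,y]]/(f)`. -/
@[reducible] noncomputable def PlaneCurve.cover (f : MvPowerSeries (Fin 2) k) (R : ArtAlg k) :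
    FlatCover R (Ideal.Quotient.mk (Ideal.span {f})) where
  P := R ⊗[k] MvPowerSeries (Fin 2) k
  aug := augmentation R (MvPowerSeries (Fin 2) k)
  aug_surjective g := ⟨1 ⊗ₜ g, augmentation_one_tmul g⟩
  aug_eq_zero_iff := augmentation_eq_zero_iff
  aug_algebraMap r := by
    change Ideal.Quotient.mk _ (augmentation R _ (r ⊗ₜ 1)) = _
    rw [augmentation_tmul, mul_one]
    rfl

/-- The algebra of a deformation of a plane curve receives a homomorphism from `R ⊗[k] k[[x,y]]`,
as it is complete. -/
theorem TopDef.exists_algHom {R : ArtAlg k} (D : TopDef (PlaneCurve.ideal f) M R) :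
    ∃ π : R ⊗[k] MvPowerSeries (Fin 2) k →ₐ[R] D.alg,
      ∀ z, D.red (π z) = Ideal.Quotient.mk (Ideal.span {f}) (augmentation R _ z) := by
  let _ : Algebra k D.alg := ((algebraMap R D.alg).comp (algebraMap k R)).toAlgebra
  have : IsScalarTower k R D.alg := IsScalarTower.of_algebraMap_eq fun _ => rfl
  have := D.complete
  obtain ⟨l, hl⟩ := exists_lift_of_isAdicComplete (PlaneCurve.ideal f) D.red D.red_surjective
    (Ideal.Quotient.mk (Ideal.span {f})) D.red_algebraMap
    (fun i => Ideal.mem_map_of_mem _ (Ideal.subset_span ⟨i, rfl⟩))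
  refine ⟨Algebra.TensorProduct.lift (Algebra.ofId R D.alg) l fun _ _ => Commute.all _ _,
    fun z => ?_⟩
  induction z with
  | zero => simp
  | add x y hx hy => simp only [map_add, hx, hy]
  | tmul r g =>
    rw [Algebra.TensorProduct.lift_tmul, map_mul, hl, augmentation_tmul, map_mul]
    exact congrArg (· * _) (D.red_algebraMap_eq r)

end PlaneCurveDeformations

end FormalDef

open FormalDef in
theorem proposition4p1p4 {k : Type u} [Field k] (f : MvPowerSeries (Fin 2) k)
    (hf : f ∈ Ideal.span {(MvPowerSeries.X 0 : MvPowerSeries (Fin 2) k), MvPowerSeries.X 1})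
    (hfin : Module.Finite k (MvPowerSeries (Fin 2) k ⧸
      Ideal.span {MvPowerSeries.pderiv k 0 f, MvPowerSeries.pderiv k 1 f}))
    (M : Type u) [AddCommGroup M] [Module (FormalDef.PlaneCurve f) M]
    [Module.Finite (FormalDef.PlaneCurve f) M]
    [Module.IsTorsionFree (FormalDef.PlaneCurve f) M]
    (hrank : FormalDef.HasGenericRankOne (FormalDef.PlaneCurve f) M) :
    FormalDef.ArtAlg.FormallySmooth
      (FormalDef.defTop (k := k) (FormalDef.PlaneCurve.ideal f) M) := by
  have hf0 : f ≠ 0 := by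
    rintro rfl
    -- the partial derivatives of `0` generate an ideal of infinite codimension
    rw [map_zero, map_zero, Set.pair_eq_singleton, Ideal.span_singleton_eq_bot.2 rfl] at hfin
    exact not_finite_mvPowerSeries
      (Module.Finite.equiv ((Submodule.quotEquivOfEqBot (⊥ : Ideal (MvPowerSeries (Fin 2) k)) rfl).restrictScalars k))
  obtain ⟨ι, hι, m, hm⟩ := exists_embedding_of_hasGenericRankOne hrank
  have hq : Function.Surjective (Ideal.Quotient.mk (Ideal.span {f})) :=
    Ideal.Quotient.mk_surjective
  obtain ⟨Q⟩ := exists_squarePresentation prime_X_zero maximalIdeal_eq_span_X hq hf0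
    Ideal.mk_ker ι hι m hm
  have hm' : ∀ a : PlaneCurve f, a • m = 0 → a = 0 := fun a ha => by
    have := congrArg ι ha
    rw [map_smul, map_zero, smul_eq_mul] at this
    exact (mul_right_mem_nonZeroDivisors_eq_zero_iff hm).1 this
  intro R S φ hφ x
  induction x using Quotient.inductionOn with
  | h D =>
    let T := PlaneCurve.cover f R
    let U := PlaneCurve.cover f S
    let e : T.P →+* U.P := (extMap φ (MvPowerSeries (Fin 2) k)).toRingHom
    have he : Function.Surjective e := extMap_surjective φ hφ
    have hTU : ∀ z, U.aug (e z) = T.aug z := augmentation_extMap φ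
    obtain ⟨π, hπ⟩ : ∃ π : U.P →ₐ[S] D.alg,
      ∀ z, D.red (π z) = Ideal.Quotient.mk (Ideal.span {f}) (U.aug z) := D.exists_algHom
    choose E hE using fun i => D.redMod_surjective (Q.gen i)
    obtain ⟨Ψ, hΨ, hdet, hcol⟩ := D.exists_matrix hq Q hm' U π hπ E hE
    -- a lift of the matrix presenting `D` to `R` gives the required deformation
    choose L hL using fun i j => he (Ψ i j)
    have hLΨ : (Matrix.of L).map e = Ψ := by ext1 i j; exact hL i j
    have hLaug : (Matrix.of L).map T.aug = Q.matrix := by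
      rw [← hΨ, ← hLΨ]
      ext1 i j
      exact (hTU _).symm
    have hLdet : e (Matrix.of L).det = Ψ.det := by
      rw [RingHom.map_det, ← hLΨ]; rfl
    obtain ⟨F⟩ := TopDef.ofMatrix_nonempty_homOver hq Q T (Matrix.of L) hLaug φ D
      ((π : U.P →+* D.alg).comp e) (fun r => by
        refine Eq.trans ?_ (π.commutes (ArtAlg.toAlgHom φ r))
        exact congrArg π (extMap_tmul φ r 1))
      (fun z => by rw [← hTU]; exact hπ (e z)) E hE ((congrArg π hLdet).trans hdet)
      (by rw [← hLΨ] at hcol; exact hcol)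
    exact ⟨Quotient.mk _ (TopDef.ofMatrix hq Q T (Matrix.of L) hLaug),
      Quotient.sound F.baseChange_iso⟩
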